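/- **Proposition 3.8 (type I geodesics).** Let $\mathbb H^3=\{x\in\mathbb R^4 : x_1^2+x_2^2+x_3^2-x_4^2=-1,\ x_4>0\}$ and let $\Gamma_3=O^+(3,1)\cap GL(4,\mathbb Z)$, acting on $\mathbb H^3$ by isometries. The group $\Gamma_3$ is generated by the reflections in the hyperplanes extending the four faces of a simplex $\Delta^3$ in $\mathbb H^3$ (one of whose vertices is ideal) whose faces $P_1,P_2,P_3,P_4$ can be labelled so that the dihedral angles are given by the linear Coxeter graph $[3,4,4]$: the angle is $\pi/3$ between $P_1,P_2$, it is $\pi/4$ between $P_2,P_3$ and between $P_3,P_4$, and it is $\pi/2$ for the other pairs. For any such $\Delta^3$ with faces so labelled, let $\gamma$ be the geodesic extending the edge $P_1\cap P_3$ and $\eta$ the geodesic extending the edge $P_1\cap P_2$ (that is, the intersections of the hyperplanes containing the corresponding two faces). Then the setwise stabilizers in $\Gamma_3$ satisfy $$\mathrm{Stab}_{\Gamma_3}(\gamma)\cong D_2\times D_\infty,\qquad \mathrm{Stab}_{\Gamma_3}(\eta)\cong D_3\times D_\infty,$$ where $D_n$ is the dihedral group of order $2n$ and $D_\infty$ is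 the infinite dihedral group. The geodesics extending the other four edges $P_1\cap P_4$, $P_2\cap P_3$, $P_2\cap P_4$, $P_3\cap P_4$ have finite stabilizers in $\Gamma_3$. -/

import Mathlib

open scoped Pointwise

/-- The Lorentzian bilinear form `x₁y₁ + x₂y₂ + x₃y₃ - x₄y₄` of signature `(3,1)` on `ℝ⁴`
(coordinates are indexed by `0, 1, 2, 3`; the last one is the timelike one). -/
noncomputable def lorentzForm : LinearMap.BilinForm ℝ (Fin 4 → ℝ) :=
  Matrix.toBilin' (Matrix.diagonal ![1, 1, 1, -1])

theorem lorentzForm_apply (x y : Fin 4 → ℝ) :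
    lorentzForm x y = x 0 * y 0 + x 1 * y 1 + x 2 * y 2 - x 3 * y 3 := by
  simp [lorentzForm, Matrix.toBilin'_apply', dotProduct, Matrix.mulVec_diagonal, Fin.sum_univ_four]
  ring

/-- Hyperbolic 3-space, in the hyperboloid model. -/
def hyperbolicSpace3 : Set (Fin 4 → ℝ) :=
  {x | lorentzForm x x = -1 ∧ 0 < x 3}

/-- The group `O⁺(3,1)` of linear automorphisms of `ℝ⁴` that preserve the Lorentzian form and the
upper sheet of the hyperboloid; it is the isometry group of hyperbolic 3-space. -/
def orthochronousLorentzGroup : Subgroup ((Fin 4 → ℝ) ≃ₗ[ℝ] (Fin 4 → ℝ)) where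
  carrier := {f | (∀ x y, lorentzForm (f x) (f y) = lorentzForm x y) ∧
    ∀ x, f x ∈ hyperbolicSpace3 ↔ x ∈ hyperbolicSpace3}
  mul_mem' := by
    rintro f g ⟨hf, hf'⟩ ⟨hg, hg'⟩
    exact ⟨fun x y => (hf _ _).trans (hg x y), fun x => (hf' _).trans (hg' x)⟩
  one_mem' := ⟨fun _ _ => rfl, fun _ => Iff.rfl⟩
  inv_mem' := by
    rintro f ⟨hf, hf'⟩
    have h : ∀ x, f (f⁻¹ x) = x := fun x => f.apply_symm_apply x
    refine ⟨fun x y => ?_, fun x => ?_⟩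
    · rw [← hf, h, h]
    · rw [← hf', h]

/-- The group `GL(4, ℤ)`, as a subgroup of the linear automorphisms of `ℝ⁴`. -/
def integralGroup4 : Subgroup ((Fin 4 → ℝ) ≃ₗ[ℝ] (Fin 4 → ℝ)) where
  carrier := {f | ∃ A : Matrix.GeneralLinearGroup (Fin 4) ℤ,
    ∀ x, f x = (A.val.map (Int.cast : ℤ → ℝ)).mulVec x}
  mul_mem' := by
    rintro f g ⟨A, hA⟩ ⟨C, hC⟩
    refine ⟨A * C, fun x => ?_⟩
    have h : ((A * C).val.map (Int.cast : ℤ → ℝ)) =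
        A.val.map (Int.cast : ℤ → ℝ) * C.val.map (Int.cast : ℤ → ℝ) := by
      rw [Units.val_mul]
      exact Matrix.map_mul (f := Int.castRingHom ℝ)
    rw [h, ← Matrix.mulVec_mulVec, ← hC, ← hA]
    rfl
  one_mem' := ⟨1, fun x => by simp⟩
  inv_mem' := by
    rintro f ⟨A, hA⟩
    refine ⟨A⁻¹, fun x => ?_⟩
    have h : A.val.map (Int.cast : ℤ → ℝ) * (A⁻¹).val.map (Int.cast : ℤ → ℝ) = 1 := by
      have h1 : (A.val * (A⁻¹).val).map (Int.castRingHom ℝ) = 1 := by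
        rw [Units.mul_inv]; simp
      rw [← h1]
      exact (Matrix.map_mul (f := Int.castRingHom ℝ)).symm
    apply f.injective
    rw [hA (Matrix.mulVec _ x), Matrix.mulVec_mulVec, h, Matrix.one_mulVec]
    exact f.apply_symm_apply x

/-- The group `Γ₃ = O⁺(3,1) ∩ GL(4, ℤ)`. -/
def Gamma3 : Subgroup ((Fin 4 → ℝ) ≃ₗ[ℝ] (Fin 4 → ℝ)) :=
  orthochronousLorentzGroup ⊓ integralGroup4

/-- The Coxeter matrix of the linear Coxeter graph `[3,4,4]`. The vertices `P₁, P₂, P₃, P₄` of the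
graph are indexed by `0, 1, 2, 3`. -/
def coxeterMatrix344 : CoxeterMatrix (Fin 4) where
  M := !![1, 3, 2, 2;
          3, 1, 4, 2;
          2, 4, 1, 4;
          2, 2, 4, 1]
  isSymm := by unfold Matrix.IsSymm; decide
  diagonal := by decide
  off_diagonal := by
    intro i j h
    fin_cases i <;> fin_cases j <;> simp at h ⊢

/-- The hyperplane (totally geodesic hyperbolic plane) of hyperbolic 3-space with normal vector
`u`. -/
def hyperbolicPlane (u : Fin 4 → ℝ) : Set (Fin 4 → ℝ) :=
  {x | x ∈ hyperbolicSpace3 ∧ lorentzForm x u = 0}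

/-- `s` is the reflection of hyperbolic space in the hyperplane with unit normal vector `u`. -/
def IsReflectionIn (s : (Fin 4 → ℝ) ≃ₗ[ℝ] (Fin 4 → ℝ)) (u : Fin 4 → ℝ) : Prop :=
  ∀ x, s x = x - (2 * lorentzForm x u) • u

/-- The vectors `v 0, …, v 3` are the inward unit normals of the faces `P₁, …, P₄` of a fundamental
simplex `{x ∈ ℍ³ | ∀ i, 0 ≤ ⟨x, v i⟩}` for `Γ₃`, labelled by the Coxeter graph `[3,4,4]`: the
simplex has interior points, the dihedral angle between the faces `i ≠ j` is `π / m i j` (for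
`i = j` the equation says that `v i` is a unit vector), and the reflections in the four
hyperplanes extending the faces generate `Γ₃`. -/
structure IsFundamentalSimplex (v : Fin 4 → Fin 4 → ℝ) : Prop where
  interior_nonempty : ∃ x ∈ hyperbolicSpace3, ∀ i, 0 < lorentzForm x (v i)
  gram : ∀ i j, lorentzForm (v i) (v j) = -Real.cos (Real.pi / (coxeterMatrix344 i j : ℝ))
  generates : Subgroup.closure {s | ∃ i, IsReflectionIn s (v i)} = Gamma3

/-- The geodesic extending the edge in which the faces `i ≠ j` of the simplex meet: the
intersection of the two hyperplanes that contain these faces. -/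
def edgeGeodesic (v : Fin 4 → Fin 4 → ℝ) (i j : Fin 4) : Set (Fin 4 → ℝ) :=
  hyperbolicPlane (v i) ∩ hyperbolicPlane (v j)

/-- The setwise stabilizer in `Γ₃` of a subset of hyperbolic 3-space. -/
abbrev gammaStab (γ : Set (Fin 4 → ℝ)) : Subgroup Gamma3 :=
  MulAction.stabilizer Gamma3 γ

/-! Everything reduces to one explicit simplex, with mirrors `x₁ = x₂`, `x₂ = x₃`, `x₃ = 0`, `x₄ =
x₁ + x₂ + x₃`. Its reflections are integral, and they generate `Γ₃` by descent on the corner entry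
of a matrix (`integralLorentzGroup_eq_mirrorGroup`). Any other admissible simplex has the same
nondegenerate Gram matrix, so an isometry carries its normals to the standard ones. This isometry
matches the two generating sets of reflections, hence normalizes `Γ₃` and conjugates stabilizers
(`nonempty_gammaStab_equiv_standard`).

An edge spans a rational Lorentzian plane, and what matters is whether the form on it is isotropic
over `ℚ`. For four edges it is: the ideal endpoints are spanned by integral vectors `m`, `n`. An
integral isometry can only fix or swap these two vectors, since the scale factors are integers with
product `1` and negative signs would exchange the sheets. So it fixes the timelike vector `m + n`,
and the integral stabilizer of such a vector is finite (`finite_fixing_timelike`).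

For the other two edges the form is `2s² - t²` or `3s² - t²`, which is anisotropic over `ℚ`. The
fundamental Pell solutions `t = 3, s = 2` and `t = 2, s = 1` give a translation, which together with
a reversal generates `D_∞`. The reflections in the two mirrors through the edge generate `D₂` or
`D₃` and commute with it. Injectivity of the map from the product follows from the action on a
lightlike eigenvector (`DihedralGroup.noncommCoprod_lift_injective`). Surjectivity is again a
descent: translating reduces to matrices fixing `(0, 0, 0, 1)`, which are signed permutations. -/

/-! ### Homomorphisms out of dihedral groups -/

namespace DihedralGroup

variable {G : Type*} [Group G]

/-- The homomorphism on the rotations of `DihedralGroup n` determined by an element `a` with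
`a ^ n = 1`. -/
noncomputable def rotationHom (n : ℕ) (a : G) (ha : a ^ n = 1) : Multiplicative (ZMod n) →* G :=
  AddMonoidHom.toMultiplicativeLeft
    (ZMod.lift n ⟨(zmultiplesHom (Additive G)) (Additive.ofMul a), by
      simpa using congrArg Additive.ofMul ha⟩)

theorem rotationHom_intCast (n : ℕ) (a : G) (ha : a ^ n = 1) (k : ℤ) :
    rotationHom n a ha (Multiplicative.ofAdd (k : ZMod n)) = a ^ k := by
  change Additive.toMul (ZMod.lift n _ (k : ZMod n)) = a ^ k
  rw [ZMod.lift_coe]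
  simp

theorem zpow_mul_reflection {a b : G} (hab : a * b = b * a⁻¹) (k : ℤ) :
    a ^ k * b = b * a ^ (-k) := by
  have h : SemiconjBy b a⁻¹ a := hab.symm
  have := h.zpow_right k
  rw [inv_zpow'] at this
  exact this.symm

/-- The homomorphism from a dihedral group determined by the images `a` of the rotation `r 1` and
`b` of the reflection `sr 0`. -/
noncomputable def lift (n : ℕ) (a b : G) (ha : a ^ n = 1) (hb : b * b = 1)
    (hab : a * b = b * a⁻¹) : DihedralGroup n →* G :=
  MonoidHom.mk'
    (fun x => match x with
      | r i => rotationHom n a ha (Multiplicative.ofAdd i)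
      | sr i => b * rotationHom n a ha (Multiplicative.ofAdd i))
    (by
      rintro (i | i) (j | j) <;> obtain ⟨i, rfl⟩ := ZMod.intCast_surjective i <;>
        obtain ⟨j, rfl⟩ := ZMod.intCast_surjective j
      · simp only [r_mul_r, ← Int.cast_add, rotationHom_intCast, zpow_add]
      · simp only [r_mul_sr, ← Int.cast_sub, rotationHom_intCast]
        rw [← mul_assoc, zpow_mul_reflection hab, mul_assoc, ← zpow_add]
        congr 2; ring
      · simp only [sr_mul_r, ← Int.cast_add, rotationHom_intCast, zpow_add, mul_assoc]
      · simp only [sr_mul_sr, ← Int.cast_sub, rotationHom_intCast]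
        rw [mul_assoc, ← mul_assoc (a ^ i), zpow_mul_reflection hab, mul_assoc, ← mul_assoc, hb,
          one_mul, ← zpow_add]
        congr 1; ring)

variable {n : ℕ} {a b : G} (ha : a ^ n = 1) (hb : b * b = 1) (hab : a * b = b * a⁻¹)

theorem lift_r_intCast (k : ℤ) : lift n a b ha hb hab (r (k : ZMod n)) = a ^ k :=
  rotationHom_intCast n a ha k

theorem lift_sr_intCast (k : ℤ) : lift n a b ha hb hab (sr (k : ZMod n)) = b * a ^ k :=
  congrArg (b * ·) (rotationHom_intCast n a ha k)

theorem lift_r_one : lift n a b ha hb hab (r 1) = a := by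
  simpa using lift_r_intCast ha hb hab 1

theorem lift_sr_zero : lift n a b ha hb hab (sr 0) = b := by
  simpa using lift_sr_intCast ha hb hab 0

theorem lift_mem {K : Subgroup G} (haK : a ∈ K) (hbK : b ∈ K) (x : DihedralGroup n) :
    lift n a b ha hb hab x ∈ K := by
  rcases x with i | i <;> obtain ⟨i, rfl⟩ := ZMod.intCast_surjective i
  · rw [lift_r_intCast]; exact K.zpow_mem haK i
  · rw [lift_sr_intCast]; exact K.mul_mem hbK (K.zpow_mem haK i)

/-- A homomorphism from the infinite dihedral group is injective on the vectors it moves: if the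
rotation scales the vector `u` by a factor greater than `1`, and the reflection moves `u` to a
vector outside of the line spanned by `u`, then only the identity fixes `u`. -/
theorem eq_one_of_lift_fixes {V : Type*} [AddCommGroup V] [Module ℝ V]
    {a b : G} (ha : a ^ 0 = 1) (hb : b * b = 1) (hab : a * b = b * a⁻¹)
    (ρ : G →* (V ≃ₗ[ℝ] V)) {u : V} (hu : u ≠ 0) {c : ℝ} (hc : 1 < c) (hau : ρ a u = c • u)
    (hbu : ∀ t : ℝ, ρ b u ≠ t • u) {x : DihedralGroup 0}
    (hx : ρ (lift 0 a b ha hb hab x) u = u) : x = 1 := by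
  have hc0 : c ≠ 0 := by positivity
  have hinv : ρ a⁻¹ u = c⁻¹ • u := by
    have h1 : ρ a⁻¹ (ρ a u) = u := by
      rw [← LinearEquiv.mul_apply, ← map_mul]; simp
    rw [hau, map_smul] at h1
    rw [← h1, smul_smul, inv_mul_cancel₀ hc0, one_smul, h1]
  have hpow : ∀ k : ℤ, ρ (a ^ k) u = c ^ k • u := by
    intro k
    induction k using Int.induction_on with
    | zero => simp
    | succ k ih =>
      rw [zpow_add, map_mul, LinearEquiv.mul_apply, zpow_one, hau, map_smul, ih, smul_smul,
        zpow_add₀ hc0, zpow_one, mul_comm]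
    | pred k ih =>
      rw [zpow_sub, map_mul, LinearEquiv.mul_apply, zpow_one, hinv, map_smul, ih, smul_smul,
        zpow_sub₀ hc0, zpow_one, mul_comm, div_eq_mul_inv]
  rcases x with i | i <;> obtain ⟨i, rfl⟩ := ZMod.intCast_surjective i
  · rw [lift_r_intCast, hpow] at hx
    have h1 : (c ^ i - 1) • u = 0 := by rw [sub_smul, hx, one_smul, sub_self]
    have h2 : c ^ i = 1 := by
      rcases smul_eq_zero.1 h1 with h | h
      · linarith
      · exact absurd h hu
    have h3 : i = 0 := by
      rwa [zpow_eq_one_iff_right₀ (by linarith) hc.ne'] at h2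
    subst h3
    rw [Int.cast_zero, r_zero]
  · rw [lift_sr_intCast, map_mul, LinearEquiv.mul_apply, hpow, map_smul] at hx
    -- Here `c ^ i • ρ b u = u`, so `ρ b u` would be a multiple of `u`.
    refine absurd ?_ (hbu (c ^ i)⁻¹)
    nth_rewrite 2 [← hx]
    rw [smul_smul, inv_mul_cancel₀ (zpow_ne_zero _ hc0), one_smul]

/-- Criterion for the injectivity of a homomorphism from the product of a dihedral group and the
infinite dihedral group. -/
theorem noncommCoprod_lift_injective {V : Type*} [AddCommGroup V] [Module ℝ V]
    {H : Type*} [Group H] (f : H →* G) (hf : Function.Injective f)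
    {a b : G} (ha : a ^ 0 = 1) (hb : b * b = 1) (hab : a * b = b * a⁻¹)
    (comm : ∀ x y, Commute (f x) (lift 0 a b ha hb hab y))
    (ρ : G →* (V ≃ₗ[ℝ] V)) {u : V} (hu : u ≠ 0) {c : ℝ} (hc : 1 < c) (hau : ρ a u = c • u)
    (hbu : ∀ t : ℝ, ρ b u ≠ t • u) (hfu : ∀ x, ρ (f x) u = u) :
    Function.Injective (f.noncommCoprod (lift 0 a b ha hb hab) comm) := by
  rw [injective_iff_map_eq_one]
  rintro ⟨x, y⟩ h
  rw [MonoidHom.noncommCoprod_apply] at h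
  have hy : y = 1 := by
    -- The image of `y` is the inverse of `f x`, and the image of `f` fixes `u`.
    refine eq_one_of_lift_fixes ha hb hab ρ hu hc hau hbu ?_
    rw [eq_inv_of_mul_eq_one_right h, ← map_inv]
    exact hfu x⁻¹
  subst hy
  simp only [map_one, mul_one] at h
  rw [(injective_iff_map_eq_one f).1 hf x h]
  rfl

end DihedralGroup

/-! ### Hyperbolic space and its isometry group -/

theorem mem_hyperbolicSpace3 {x : Fin 4 → ℝ} :
    x ∈ hyperbolicSpace3 ↔ x 0 * x 0 + x 1 * x 1 + x 2 * x 2 - x 3 * x 3 = -1 ∧ 0 < x 3 := by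
  rw [hyperbolicSpace3, Set.mem_ofPred_eq, lorentzForm_apply]

/-- Reverse Cauchy-Schwarz: the sign of the form detects the sheet of the hyperboloid. -/
theorem mem_hyperbolicSpace3_iff_lorentzForm_neg {x y : Fin 4 → ℝ} (hx : x ∈ hyperbolicSpace3)
    (hy : lorentzForm y y = -1) : y ∈ hyperbolicSpace3 ↔ lorentzForm x y < 0 := by
  rw [mem_hyperbolicSpace3] at hx ⊢
  obtain ⟨hx, hx3⟩ := hx
  rw [lorentzForm_apply] at hy ⊢
  have hcs : (x 0 * y 0 + x 1 * y 1 + x 2 * y 2) ^ 2 ≤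
      (x 0 * x 0 + x 1 * x 1 + x 2 * x 2) * (y 0 * y 0 + y 1 * y 1 + y 2 * y 2) := by
    nlinarith [sq_nonneg (x 0 * y 1 - x 1 * y 0), sq_nonneg (x 0 * y 2 - x 2 * y 0),
      sq_nonneg (x 1 * y 2 - x 2 * y 1)]
  have hxe : x 0 * x 0 + x 1 * x 1 + x 2 * x 2 = x 3 * x 3 - 1 := by linarith
  have hye : y 0 * y 0 + y 1 * y 1 + y 2 * y 2 = y 3 * y 3 - 1 := by linarith
  have hy1 : 1 ≤ y 3 * y 3 := by
    nlinarith [mul_self_nonneg (y 0), mul_self_nonneg (y 1), mul_self_nonneg (y 2)]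
  have hx1 : 1 ≤ x 3 * x 3 := by
    nlinarith [mul_self_nonneg (x 0), mul_self_nonneg (x 1), mul_self_nonneg (x 2)]
  rw [hxe, hye] at hcs
  have habs : |x 0 * y 0 + x 1 * y 1 + x 2 * y 2| < |x 3 * y 3| := by
    rw [← sq_lt_sq]
    nlinarith
  constructor
  · rintro ⟨-, hy3⟩
    rw [abs_of_pos (mul_pos hx3 hy3)] at habs
    linarith [(abs_lt.1 habs).2]
  · intro h
    refine ⟨hy, ?_⟩
    by_contra hn
    have h0 : x 3 * y 3 ≤ 0 := mul_nonpos_of_nonneg_of_nonpos hx3.le (not_lt.1 hn)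
    rw [abs_of_nonpos h0, neg_eq_neg_one_mul] at habs
    linarith [(abs_lt.1 habs).1]

/-- The sign of the form against one reference point decides the sheet, so for a form-preserving map
it is enough to test a single point. -/
theorem mem_orthochronousLorentzGroup {f : (Fin 4 → ℝ) ≃ₗ[ℝ] (Fin 4 → ℝ)}
    (hf : ∀ x y, lorentzForm (f x) (f y) = lorentzForm x y) {x₀ : Fin 4 → ℝ}
    (hx₀ : x₀ ∈ hyperbolicSpace3) (hfx₀ : f x₀ ∈ hyperbolicSpace3) :
    f ∈ orthochronousLorentzGroup := by
  refine ⟨hf, fun x => ?_⟩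
  by_cases hx : lorentzForm x x = -1
  · rw [mem_hyperbolicSpace3_iff_lorentzForm_neg hx₀ hx,
      mem_hyperbolicSpace3_iff_lorentzForm_neg hfx₀ ((hf x x).trans hx), hf]
  · exact iff_of_false (fun h => hx ((hf x x).symm.trans h.1)) fun h => hx h.1

/-! ### Integral Lorentz transformations -/

/-- The action of integral matrices on `ℝ⁴`. -/
noncomputable def integralAction :
    Matrix.GeneralLinearGroup (Fin 4) ℤ →* ((Fin 4 → ℝ) ≃ₗ[ℝ] (Fin 4 → ℝ)) :=
  ((LinearMap.GeneralLinearGroup.generalLinearEquiv ℝ (Fin 4 → ℝ)).toMonoidHom.comp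
    (Matrix.GeneralLinearGroup.toLin (n := Fin 4) (R := ℝ)).toMonoidHom).comp
    (Matrix.GeneralLinearGroup.map (Int.castRingHom ℝ))

theorem integralAction_apply (A : Matrix.GeneralLinearGroup (Fin 4) ℤ) (x : Fin 4 → ℝ) :
    integralAction A x = (A.val.map (Int.cast : ℤ → ℝ)).mulVec x := rfl

theorem integralAction_apply_coord (A : Matrix.GeneralLinearGroup (Fin 4) ℤ) (x : Fin 4 → ℝ)
    (i : Fin 4) : integralAction A x i =
      A.val i 0 * x 0 + A.val i 1 * x 1 + A.val i 2 * x 2 + A.val i 3 * x 3 := by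
  rw [integralAction_apply]
  simp [Matrix.mulVec, dotProduct, Fin.sum_univ_four]

theorem integralAction_single (A : Matrix.GeneralLinearGroup (Fin 4) ℤ) (i j : Fin 4) :
    integralAction A (Pi.single j 1) i = A.val i j := by
  rw [integralAction_apply]
  simp

theorem integralAction_injective : Function.Injective integralAction := by
  intro A B h
  ext i j
  have := integralAction_single A i j
  rw [h, integralAction_single] at this
  exact_mod_cast this.symm

theorem integralGroup4_eq_range : integralGroup4 = integralAction.range := by
  ext f
  constructor
  · rintro ⟨A, hA⟩
    exact ⟨A, LinearEquiv.ext fun x => (hA x).symm⟩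
  · rintro ⟨A, rfl⟩
    exact ⟨A, fun x => integralAction_apply A x⟩

theorem exists_integralAction_eq {f : (Fin 4 → ℝ) ≃ₗ[ℝ] (Fin 4 → ℝ)} (hf : f ∈ Gamma3) :
    ∃ A, integralAction A = f := by
  have := hf.2
  rwa [integralGroup4_eq_range] at this

theorem integralAction_mem_Gamma3_iff {A : Matrix.GeneralLinearGroup (Fin 4) ℤ} :
    integralAction A ∈ Gamma3 ↔ integralAction A ∈ orthochronousLorentzGroup := by
  refine ⟨fun h => h.1, fun h => ⟨h, ?_⟩⟩
  rw [integralGroup4_eq_range]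
  exact ⟨A, rfl⟩

/-- `Γ₃` as a group of integral matrices. -/
noncomputable def integralLorentzGroup : Subgroup (Matrix.GeneralLinearGroup (Fin 4) ℤ) :=
  Gamma3.comap integralAction

theorem map_integralLorentzGroup : integralLorentzGroup.map integralAction = Gamma3 := by
  rw [integralLorentzGroup, Subgroup.map_comap_eq, ← integralGroup4_eq_range]
  exact inf_eq_right.2 inf_le_right

theorem lorentzForm_single (i j : Fin 4) :
    lorentzForm (Pi.single i 1) (Pi.single j 1) =
      (Matrix.diagonal ![1, 1, 1, -1] : Matrix (Fin 4) (Fin 4) ℝ) i j := by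
  rw [lorentzForm, Matrix.toBilin'_single]

/-- The columns of a matrix in `Γ₃` form a Lorentz orthonormal basis. -/
theorem column_orthonormal {A : Matrix.GeneralLinearGroup (Fin 4) ℤ}
    (hA : A ∈ integralLorentzGroup) (i j : Fin 4) :
    A.val 0 i * A.val 0 j + A.val 1 i * A.val 1 j + A.val 2 i * A.val 2 j
      - A.val 3 i * A.val 3 j = (Matrix.diagonal ![1, 1, 1, -1] : Matrix (Fin 4) (Fin 4) ℤ) i j := by
  have h := hA.1.1 (Pi.single i 1) (Pi.single j 1)
  rw [lorentzForm_apply] at h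
  simp only [integralAction_single] at h
  rw [lorentzForm_single] at h
  have h' : ((A.val 0 i * A.val 0 j + A.val 1 i * A.val 1 j + A.val 2 i * A.val 2 j
      - A.val 3 i * A.val 3 j : ℤ) : ℝ) =
      ((Matrix.diagonal ![1, 1, 1, -1] : Matrix (Fin 4) (Fin 4) ℤ) i j : ℤ) := by
    push_cast
    rw [h]
    fin_cases i <;> fin_cases j <;> simp [Matrix.diagonal]
  exact_mod_cast h'

theorem single_three_mem_hyperbolicSpace3 :
    (Pi.single 3 1 : Fin 4 → ℝ) ∈ hyperbolicSpace3 := by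
  rw [mem_hyperbolicSpace3]
  simp

theorem corner_pos {A : Matrix.GeneralLinearGroup (Fin 4) ℤ}
    (hA : A ∈ integralLorentzGroup) : 0 < A.val 3 3 := by
  have h := ((hA.1.2 _).2 single_three_mem_hyperbolicSpace3).2
  rw [integralAction_single] at h
  exact_mod_cast h

/-- Both hypotheses are decidable for explicit matrices. The corner entry is the last coordinate of
the image of `(0, 0, 0, 1)`, so its sign excludes an exchange of sheets. -/
theorem mem_integralLorentzGroup {A : Matrix.GeneralLinearGroup (Fin 4) ℤ}
    (h : A.val.transpose * Matrix.diagonal ![1, 1, 1, -1] * A.val = Matrix.diagonal ![1, 1, 1, -1])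
    (h3 : 0 < A.val 3 3) : A ∈ integralLorentzGroup := by
  have key : ∀ x y, lorentzForm (integralAction A x) (integralAction A y) = lorentzForm x y := by
    have hR := congrArg (fun M => M.map (Int.castRingHom ℝ)) h
    simp only [Matrix.map_mul] at hR
    have hd : (Matrix.diagonal ![1, 1, 1, -1] : Matrix (Fin 4) (Fin 4) ℤ).map (Int.castRingHom ℝ)
        = Matrix.diagonal ![1, 1, 1, -1] := by
      ext i j
      fin_cases i <;> fin_cases j <;> simp [Matrix.diagonal]
    rw [hd, Matrix.transpose_map] at hR
    intro x y
    rw [lorentzForm, Matrix.toBilin'_apply', Matrix.toBilin'_apply', integralAction_apply,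
      integralAction_apply]
    have e (M D : Matrix (Fin 4) (Fin 4) ℝ) :
        M.mulVec x ⬝ᵥ D.mulVec (M.mulVec y) = x ⬝ᵥ (M.transpose * D * M).mulVec y := by
      simp only [← Matrix.mulVec_mulVec]
      rw [Matrix.mulVec_transpose, dotProduct_comm x, ← Matrix.dotProduct_mulVec, dotProduct_comm]
    exact (e _ _).trans (congrArg (fun N => x ⬝ᵥ Matrix.mulVec N y) hR)
  refine integralAction_mem_Gamma3_iff.2
    (mem_orthochronousLorentzGroup key single_three_mem_hyperbolicSpace3 ⟨?_, ?_⟩)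
  · rw [key]; exact single_three_mem_hyperbolicSpace3.1
  · rw [integralAction_single]; exact_mod_cast h3

/-! ### Generation of `Γ₃` by reflections -/

/-- The matrices of the reflections in the faces of the standard fundamental simplex. -/
def mirrorMatrix : Fin 4 → Matrix (Fin 4) (Fin 4) ℤ :=
  ![!![0, 1, 0, 0; 1, 0, 0, 0; 0, 0, 1, 0; 0, 0, 0, 1],
    !![1, 0, 0, 0; 0, 0, 1, 0; 0, 1, 0, 0; 0, 0, 0, 1],
    !![1, 0, 0, 0; 0, 1, 0, 0; 0, 0, -1, 0; 0, 0, 0, 1],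
    !![0, -1, -1, 1; -1, 0, -1, 1; -1, -1, 0, 1; -1, -1, -1, 2]]

theorem mirrorMatrix_mul_self (i : Fin 4) : mirrorMatrix i * mirrorMatrix i = 1 := by
  revert i; decide +kernel

/-- The reflections in the faces of the standard fundamental simplex. -/
def mirror (i : Fin 4) : Matrix.GeneralLinearGroup (Fin 4) ℤ :=
  ⟨mirrorMatrix i, mirrorMatrix i, mirrorMatrix_mul_self i, mirrorMatrix_mul_self i⟩

/-- The group generated by the reflections in the faces of the standard fundamental simplex. -/
def mirrorGroup : Subgroup (Matrix.GeneralLinearGroup (Fin 4) ℤ) :=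
  Subgroup.closure (Set.range mirror)

theorem mirror_mem_mirrorGroup (i : Fin 4) : mirror i ∈ mirrorGroup :=
  Subgroup.subset_closure ⟨i, rfl⟩

theorem mirror_mem_integralLorentzGroup (i : Fin 4) : mirror i ∈ integralLorentzGroup := by
  apply mem_integralLorentzGroup
  · revert i; decide +kernel
  · revert i; decide +kernel

theorem mirrorGroup_le : mirrorGroup ≤ integralLorentzGroup := by
  rw [mirrorGroup, Subgroup.closure_le]
  rintro _ ⟨i, rfl⟩
  exact mirror_mem_integralLorentzGroup i

theorem col_mul (S A : Matrix.GeneralLinearGroup (Fin 4) ℤ) (j : Fin 4) :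
    (S * A).val.col j = S.val.mulVec (A.val.col j) := rfl

theorem ext_col {A B : Matrix.GeneralLinearGroup (Fin 4) ℤ}
    (h0 : A.val.col 0 = B.val.col 0) (h1 : A.val.col 1 = B.val.col 1)
    (h2 : A.val.col 2 = B.val.col 2) (h3 : A.val.col 3 = B.val.col 3) : A = B := by
  ext i j
  fin_cases j
  exacts [congrFun h0 i, congrFun h1 i, congrFun h2 i, congrFun h3 i]

theorem int_unit_vector {a b c : ℤ} (h : a * a + b * b + c * c = 1) :
    (a = 1 ∧ b = 0 ∧ c = 0) ∨ (a = -1 ∧ b = 0 ∧ c = 0) ∨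
    (a = 0 ∧ b = 1 ∧ c = 0) ∨ (a = 0 ∧ b = -1 ∧ c = 0) ∨
    (a = 0 ∧ b = 0 ∧ c = 1) ∨ (a = 0 ∧ b = 0 ∧ c = -1) := by
  have ha : -1 ≤ a ∧ a ≤ 1 := by constructor <;> nlinarith [mul_self_nonneg b, mul_self_nonneg c]
  have hb : -1 ≤ b ∧ b ≤ 1 := by constructor <;> nlinarith [mul_self_nonneg a, mul_self_nonneg c]
  have hc : -1 ≤ c ∧ c ≤ 1 := by constructor <;> nlinarith [mul_self_nonneg b, mul_self_nonneg a]
  obtain ⟨ha1, ha2⟩ := ha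
  obtain ⟨hb1, hb2⟩ := hb
  obtain ⟨hc1, hc2⟩ := hc
  interval_cases a <;> interval_cases b <;> interval_cases c <;> simp_all

/-- A matrix in `Γ₃` that fixes the last basis vector permutes the other three up to sign. -/
theorem unit_column {A : Matrix.GeneralLinearGroup (Fin 4) ℤ} (hA : A ∈ integralLorentzGroup)
    (h3 : A.val.col 3 = ![0, 0, 0, 1]) {j : Fin 4} (hj : j ≠ 3) :
    A.val.col j = ![1, 0, 0, 0] ∨ A.val.col j = ![-1, 0, 0, 0] ∨ A.val.col j = ![0, 1, 0, 0] ∨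
    A.val.col j = ![0, -1, 0, 0] ∨ A.val.col j = ![0, 0, 1, 0] ∨ A.val.col j = ![0, 0, -1, 0] := by
  have e0 : A.val 0 3 = 0 := congrFun h3 0
  have e1 : A.val 1 3 = 0 := congrFun h3 1
  have e2 : A.val 2 3 = 0 := congrFun h3 2
  have e3 : A.val 3 3 = 1 := congrFun h3 3
  have hj3 := column_orthonormal hA j 3
  rw [e0, e1, e2, e3, Matrix.diagonal_apply_ne _ hj] at hj3
  have hz : A.val 3 j = 0 := by linarith
  have hjj := column_orthonormal hA j j
  rw [hz, Matrix.diagonal_apply_eq] at hjj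
  have h1 : A.val 0 j * A.val 0 j + A.val 1 j * A.val 1 j + A.val 2 j * A.val 2 j = 1 := by
    fin_cases j <;> simp_all
  have hcol : ∀ a b c : ℤ, A.val 0 j = a ∧ A.val 1 j = b ∧ A.val 2 j = c →
      A.val.col j = ![a, b, c, 0] := by
    rintro a b c ⟨rfl, rfl, rfl⟩
    funext i
    fin_cases i <;> simp [Matrix.col, hz]
  exact (int_unit_vector h1).imp (hcol _ _ _) (Or.imp (hcol _ _ _) (Or.imp (hcol _ _ _)
    (Or.imp (hcol _ _ _) (Or.imp (hcol _ _ _) (hcol _ _ _)))))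

/-- The reflections that change the sign of one coordinate. -/
def signMatrix : Fin 3 → Matrix (Fin 4) (Fin 4) ℤ :=
  ![Matrix.diagonal ![-1, 1, 1, 1], Matrix.diagonal ![1, -1, 1, 1], Matrix.diagonal ![1, 1, -1, 1]]

/-- The sign changes are conjugates of `mirror 2` by coordinate permutations. -/
theorem exists_sign (i : Fin 3) : ∃ S ∈ mirrorGroup, S.val = signMatrix i := by
  have m := mirror_mem_mirrorGroup
  fin_cases i
  · exact ⟨mirror 0 * (mirror 1 * mirror 2 * mirror 1) * mirror 0, mul_mem (mul_mem (m 0)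
      (mul_mem (mul_mem (m 1) (m 2)) (m 1))) (m 0), by decide +kernel⟩
  · exact ⟨mirror 1 * mirror 2 * mirror 1, mul_mem (mul_mem (m 1) (m 2)) (m 1), by decide +kernel⟩
  · exact ⟨mirror 2, m 2, by decide +kernel⟩

/-- Orthogonality leaves only a sign for the third column: the matrix is the identity or `mirror 2`.
-/
theorem mem_of_fixes_three {A : Matrix.GeneralLinearGroup (Fin 4) ℤ}
    (hA : A ∈ integralLorentzGroup) (h3 : A.val.col 3 = ![0, 0, 0, 1])
    (h0 : A.val.col 0 = ![1, 0, 0, 0]) (h1 : A.val.col 1 = ![0, 1, 0, 0]) :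
    A ∈ mirrorGroup := by
  have o02 := column_orthonormal hA 0 2
  have o12 := column_orthonormal hA 1 2
  have c0 (i) : A.val i 0 = _ := congrFun h0 i
  have c1 (i) : A.val i 1 = _ := congrFun h1 i
  simp only [c0, c1] at o02 o12
  have h2 := unit_column hA h3 (j := 2) (by decide)
  have c (v : Fin 4 → ℤ) (i) (h : A.val.col 2 = v) : A.val i 2 = v i := congrFun h i
  rcases h2 with h2 | h2 | h2 | h2 | h2 | h2
  · simp [c _ _ h2] at o02
  · simp [c _ _ h2] at o02
  · simp [c _ _ h2] at o12
  · simp [c _ _ h2] at o12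
  · convert mirrorGroup.one_mem
    exact ext_col (h0.trans (by decide +kernel)) (h1.trans (by decide +kernel))
      (h2.trans (by decide +kernel)) (h3.trans (by decide +kernel))
  · convert mirror_mem_mirrorGroup 2
    exact ext_col (h0.trans (by decide +kernel)) (h1.trans (by decide +kernel))
      (h2.trans (by decide +kernel)) (h3.trans (by decide +kernel))

theorem mem_of_fixes_two {A : Matrix.GeneralLinearGroup (Fin 4) ℤ}
    (hA : A ∈ integralLorentzGroup) (h3 : A.val.col 3 = ![0, 0, 0, 1])
    (h0 : A.val.col 0 = ![1, 0, 0, 0]) : A ∈ mirrorGroup := by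
  have o01 := column_orthonormal hA 0 1
  have c0 (i) : A.val i 0 = _ := congrFun h0 i
  simp only [c0] at o01
  have step {S : Matrix.GeneralLinearGroup (Fin 4) ℤ} (hS : S ∈ mirrorGroup)
      (e3 : S.val.mulVec ![0, 0, 0, 1] = ![0, 0, 0, 1])
      (e0 : S.val.mulVec ![1, 0, 0, 0] = ![1, 0, 0, 0])
      (e1 : S.val.mulVec (A.val.col 1) = ![0, 1, 0, 0]) : A ∈ mirrorGroup := by
    refine (mirrorGroup.mul_mem_cancel_left hS).1
      (mem_of_fixes_three (mul_mem (mirrorGroup_le hS) hA) ?_ ?_ ?_)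
    · rw [col_mul, h3, e3]
    · rw [col_mul, h0, e0]
    · rw [col_mul, e1]
  have c (v : Fin 4 → ℤ) (i) (h : A.val.col 1 = v) : A.val i 1 = v i := congrFun h i
  obtain ⟨S1, hS1, e1⟩ := exists_sign 1
  have m := mirror_mem_mirrorGroup
  rcases unit_column hA h3 (j := 1) (by decide) with h | h | h | h | h | h
  · simp [c _ _ h] at o01
  · simp [c _ _ h] at o01
  · exact mem_of_fixes_three hA h3 h0 h
  · refine step hS1 ?_ ?_ (h ▸ ?_) <;> rw [e1] <;> decide +kernel
  · exact step (m 1) (by decide +kernel) (by decide +kernel) (h ▸ by decide +kernel)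
  · exact step (mul_mem (m 1) (m 2)) (by decide +kernel) (by decide +kernel)
      (h ▸ by decide +kernel)

/-- The stabilizer of the point `(0, 0, 0, 1)` in `Γ₃` is generated by reflections. -/
theorem mem_mirrorGroup_of_fixes_origin {A : Matrix.GeneralLinearGroup (Fin 4) ℤ}
    (hA : A ∈ integralLorentzGroup) (h3 : A.val.col 3 = ![0, 0, 0, 1]) : A ∈ mirrorGroup := by
  have step {S : Matrix.GeneralLinearGroup (Fin 4) ℤ} (hS : S ∈ mirrorGroup)
      (e3 : S.val.mulVec ![0, 0, 0, 1] = ![0, 0, 0, 1])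
      (e0 : S.val.mulVec (A.val.col 0) = ![1, 0, 0, 0]) : A ∈ mirrorGroup := by
    refine (mirrorGroup.mul_mem_cancel_left hS).1
      (mem_of_fixes_two (mul_mem (mirrorGroup_le hS) hA) ?_ ?_)
    · rw [col_mul, h3, e3]
    · rw [col_mul, e0]
  obtain ⟨S0, hS0, e0⟩ := exists_sign 0
  have m := mirror_mem_mirrorGroup
  rcases unit_column hA h3 (j := 0) (by decide) with h | h | h | h | h | h
  · exact mem_of_fixes_two hA h3 h
  · refine step hS0 ?_ (h ▸ ?_) <;> rw [e0] <;> decide +kernel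
  · exact step (m 0) (by decide +kernel) (h ▸ by decide +kernel)
  · exact step (mul_mem (mul_mem (m 0) (m 1)) (mul_mem (m 2) (m 1))) (by decide +kernel)
      (h ▸ by decide +kernel)
  · exact step (mul_mem (m 0) (m 1)) (by decide +kernel) (h ▸ by decide +kernel)
  · exact step (mul_mem (mul_mem (m 0) (m 1)) (m 2)) (by decide +kernel) (h ▸ by decide +kernel)

theorem exists_mulVec_eq_update_abs (i : Fin 3) (v : Fin 4 → ℤ) : ∃ S ∈ mirrorGroup,
    S.val.mulVec v = Function.update v i.castSucc |v i.castSucc| := by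
  rcases le_total 0 (v i.castSucc) with h | h
  · exact ⟨1, one_mem _, by simp [abs_of_nonneg h]⟩
  · obtain ⟨S, hS, e⟩ := exists_sign i
    refine ⟨S, hS, ?_⟩
    rw [e, abs_of_nonpos h]
    funext j
    fin_cases i <;> fin_cases j <;> simp [signMatrix, Matrix.mulVec_diagonal]

theorem exists_sign_mul (A : Matrix.GeneralLinearGroup (Fin 4) ℤ) :
    ∃ S ∈ mirrorGroup, (S * A).val.col 3 =
      ![|A.val 0 3|, |A.val 1 3|, |A.val 2 3|, A.val 3 3] := by
  obtain ⟨S0, h0, e0⟩ := exists_mulVec_eq_update_abs 0 (A.val.col 3)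
  obtain ⟨S1, h1, e1⟩ := exists_mulVec_eq_update_abs 1 ((S0 * A).val.col 3)
  obtain ⟨S2, h2, e2⟩ := exists_mulVec_eq_update_abs 2 ((S1 * (S0 * A)).val.col 3)
  refine ⟨S2 * (S1 * S0), mul_mem h2 (mul_mem h1 h0), ?_⟩
  rw [mul_assoc, mul_assoc, col_mul, e2, col_mul, e1, col_mul, e0]
  funext j
  fin_cases j <;> simp [Function.update, Matrix.col]

/-- Write the column as `(a, b, c, d)` and `s = a + b + c`, so `d² = a² + b² + c² + 1`. If `d ≥ s +
1`, then `d² ≥ s² + 2s + 1` forces `s = 0`. If `d = s`, then `2(ab + ac + bc) = 1`, which is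
impossible by parity. This is where the descent stops. -/
theorem column_eq_origin {A : Matrix.GeneralLinearGroup (Fin 4) ℤ}
    (hA : A ∈ integralLorentzGroup) (h0 : 0 ≤ A.val 0 3) (h1 : 0 ≤ A.val 1 3)
    (h2 : 0 ≤ A.val 2 3) (hle : A.val 0 3 + A.val 1 3 + A.val 2 3 ≤ A.val 3 3) :
    A.val.col 3 = ![0, 0, 0, 1] := by
  have h := column_orthonormal hA 3 3
  have hpos := corner_pos hA
  have h' : A.val 0 3 * A.val 0 3 + A.val 1 3 * A.val 1 3 + A.val 2 3 * A.val 2 3 + 1 =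
    A.val 3 3 * A.val 3 3 := by
    have : (Matrix.diagonal ![1, 1, 1, -1] : Matrix (Fin 4) (Fin 4) ℤ) 3 3 = -1 := by decide
    linarith
  have h01 := mul_nonneg h0 h1
  have h02 := mul_nonneg h0 h2
  have h12 := mul_nonneg h1 h2
  rcases lt_or_eq_of_le hle with hs | hs
  · have hs' : A.val 0 3 + A.val 1 3 + A.val 2 3 + 1 ≤ A.val 3 3 := hs
    have hz : A.val 0 3 + A.val 1 3 + A.val 2 3 = 0 := by nlinarith
    have z0 : A.val 0 3 = 0 := by omega
    have z1 : A.val 1 3 = 0 := by omega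
    have z2 : A.val 2 3 = 0 := by omega
    rw [z0, z1, z2] at h'
    have z3 : A.val 3 3 = 1 := by nlinarith
    funext i
    fin_cases i
    exacts [z0, z1, z2, z3]
  · rw [← hs] at h'
    have : 2 * (A.val 0 3 * A.val 1 3 + A.val 0 3 * A.val 2 3 + A.val 1 3 * A.val 2 3) = 1 := by
      linarith
    omega

/-- Descent on the positive corner entry `d`. After sign changes the last column `(a, b, c, d)` has
nonnegative entries. If `a + b + c > d`, then `mirror 3` replaces `d` by `2d - a - b - c < d`;
otherwise the matrix fixes `(0, 0, 0, 1)`. -/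
theorem integralLorentzGroup_eq_mirrorGroup : integralLorentzGroup = mirrorGroup := by
  refine le_antisymm (fun A hA => ?_) mirrorGroup_le
  suffices H : ∀ (n : ℕ) (A), A ∈ integralLorentzGroup → A.val 3 3 ≤ n → A ∈ mirrorGroup from
    H (A.val 3 3).toNat A hA (Int.self_le_toNat _)
  clear hA A
  intro n
  induction n with
  | zero =>
    intro A hA hn
    exact absurd (corner_pos hA) (not_lt.2 hn)
  | succ n ih =>
    intro A hA hn
    obtain ⟨S, hS, hcol⟩ := exists_sign_mul A
    refine (mirrorGroup.mul_mem_cancel_left hS).1 ?_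
    have hB : S * A ∈ integralLorentzGroup := mul_mem (mirrorGroup_le hS) hA
    generalize S * A = B at hcol hB
    have b0 : B.val 0 3 = _ := congrFun hcol 0
    have b1 : B.val 1 3 = _ := congrFun hcol 1
    have b2 : B.val 2 3 = _ := congrFun hcol 2
    have b3 : B.val 3 3 = _ := congrFun hcol 3
    simp only [Matrix.cons_val] at b0 b1 b2 b3
    by_cases hle : B.val 0 3 + B.val 1 3 + B.val 2 3 ≤ B.val 3 3
    · exact mem_mirrorGroup_of_fixes_origin hB (column_eq_origin hB (b0 ▸ abs_nonneg _)
        (b1 ▸ abs_nonneg _) (b2 ▸ abs_nonneg _) hle)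
    · refine (mirrorGroup.mul_mem_cancel_left (mirror_mem_mirrorGroup 3)).1
        (ih _ (mul_mem (mirror_mem_integralLorentzGroup 3) hB) ?_)
      have : (mirror 3 * B).val 3 3 =
          -B.val 0 3 - B.val 1 3 - B.val 2 3 + 2 * B.val 3 3 := by
        rw [Units.val_mul, Matrix.mul_apply, Fin.sum_univ_four]
        simp [mirror, mirrorMatrix]
        ring
      push_cast at hn
      linarith

/-! ### The standard fundamental simplex -/

/-- The unit normals of the faces of the standard fundamental simplex
`x₁ ≥ x₂ ≥ x₃ ≥ 0`, `x₄ ≥ x₁ + x₂ + x₃`. -/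
noncomputable def standardNormal : Fin 4 → Fin 4 → ℝ :=
  ![(√2)⁻¹ • ![1, -1, 0, 0], (√2)⁻¹ • ![0, 1, -1, 0], ![0, 0, 1, 0],
    (√2)⁻¹ • ![-1, -1, -1, -1]]

theorem lorentzForm_standardNormal_zero (x : Fin 4 → ℝ) :
    lorentzForm x (standardNormal 0) = (√2)⁻¹ * (x 0 - x 1) := by
  rw [lorentzForm_apply]; simp [standardNormal]; ring

theorem lorentzForm_standardNormal_one (x : Fin 4 → ℝ) :
    lorentzForm x (standardNormal 1) = (√2)⁻¹ * (x 1 - x 2) := by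
  rw [lorentzForm_apply]; simp [standardNormal]; ring

theorem lorentzForm_standardNormal_two (x : Fin 4 → ℝ) :
    lorentzForm x (standardNormal 2) = x 2 := by
  rw [lorentzForm_apply]; simp [standardNormal]

theorem lorentzForm_standardNormal_three (x : Fin 4 → ℝ) :
    lorentzForm x (standardNormal 3) = (√2)⁻¹ * (x 3 - x 0 - x 1 - x 2) := by
  rw [lorentzForm_apply]; simp [standardNormal]; ring

theorem inv_sqrt_two_mul_self : (√2)⁻¹ * (√2)⁻¹ = (1 / 2 : ℝ) := by
  rw [← mul_inv, Real.mul_self_sqrt (by norm_num)]; norm_num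

theorem isReflectionIn_mirror (i : Fin 4) :
    IsReflectionIn (integralAction (mirror i)) (standardNormal i) := by
  intro x
  have h := inv_sqrt_two_mul_self
  fin_cases i <;> funext j <;> rw [integralAction_apply_coord] <;>
    simp only [Fin.zero_eta, Fin.mk_one, Fin.reduceFinMk, lorentzForm_standardNormal_zero,
      lorentzForm_standardNormal_one, lorentzForm_standardNormal_two,
      lorentzForm_standardNormal_three] <;>
    fin_cases j <;> simp [standardNormal, mirror, mirrorMatrix] <;>
    first
    | ring1
    | linear_combination (2 * (x 0 - x 1)) * h
    | linear_combination (-2 * (x 0 - x 1)) * h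
    | linear_combination (2 * (x 1 - x 2)) * h
    | linear_combination (-2 * (x 1 - x 2)) * h
    | linear_combination (-2 * (x 3 - x 0 - x 1 - x 2)) * h

theorem isReflectionIn_standardNormal_iff {s : (Fin 4 → ℝ) ≃ₗ[ℝ] (Fin 4 → ℝ)} {i : Fin 4} :
    IsReflectionIn s (standardNormal i) ↔ integralAction (mirror i) = s :=
  ⟨fun h => LinearEquiv.ext fun x => (isReflectionIn_mirror i x).trans (h x).symm,
    fun h => h ▸ isReflectionIn_mirror i⟩

theorem closure_reflections_standardNormal :
    Subgroup.closure {s | ∃ i, IsReflectionIn s (standardNormal i)} = Gamma3 := by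
  have : {s | ∃ i, IsReflectionIn s (standardNormal i)} = integralAction '' Set.range mirror := by
    ext s
    simp [isReflectionIn_standardNormal_iff]
  rw [this, ← MonoidHom.map_closure, ← map_integralLorentzGroup,
    integralLorentzGroup_eq_mirrorGroup, mirrorGroup]

theorem gram_standardNormal (i j : Fin 4) : lorentzForm (standardNormal i) (standardNormal j) =
    -Real.cos (Real.pi / (coxeterMatrix344 i j : ℝ)) := by
  have h := inv_sqrt_two_mul_self
  have h' : (√2)⁻¹ = √2 / 2 := by
    rw [inv_eq_one_div, div_eq_div_iff (by positivity) (by norm_num),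
      Real.mul_self_sqrt (by norm_num)]; norm_num
  fin_cases j <;> fin_cases i <;>
  simp [lorentzForm_standardNormal_zero, lorentzForm_standardNormal_one,
    lorentzForm_standardNormal_two, lorentzForm_standardNormal_three, coxeterMatrix344] <;>
  simp [standardNormal] <;> linarith

theorem standardNormal_interior_nonempty :
    ∃ x ∈ hyperbolicSpace3, ∀ i, 0 < lorentzForm x (standardNormal i) := by
  have h35 : (√35)⁻¹ * (√35)⁻¹ = (1 / 35 : ℝ) := by
    rw [← mul_inv, Real.mul_self_sqrt (by norm_num)]; norm_num
  have hp : 0 < (√35)⁻¹ := by positivity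
  -- The vector satisfies `3 > 2 > 1 > 0` and `7 > 3 + 2 + 1`, and has norm `-35`.
  refine ⟨(√35)⁻¹ • ![3, 2, 1, 7], ?_, fun i => ?_⟩
  · rw [mem_hyperbolicSpace3]
    simp
    linear_combination (-35) * h35
  · fin_cases i <;>
    simp [lorentzForm_standardNormal_zero, lorentzForm_standardNormal_one,
      lorentzForm_standardNormal_two, lorentzForm_standardNormal_three] <;> linarith

theorem isFundamentalSimplex_standardNormal : IsFundamentalSimplex standardNormal :=
  ⟨standardNormal_interior_nonempty, gram_standardNormal, closure_reflections_standardNormal⟩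

theorem pos_of_mem_standard_cone {x : Fin 4 → ℝ}
    (h : ∀ i, 0 < lorentzForm x (standardNormal i)) : 0 < x 3 := by
  have h0 := h 0
  have h1 := h 1
  have h2 := h 2
  have h3 := h 3
  have hs : 0 < (√2 : ℝ)⁻¹ := by positivity
  rw [lorentzForm_standardNormal_zero, mul_pos_iff_of_pos_left hs] at h0
  rw [lorentzForm_standardNormal_one, mul_pos_iff_of_pos_left hs] at h1
  rw [lorentzForm_standardNormal_two] at h2
  rw [lorentzForm_standardNormal_three, mul_pos_iff_of_pos_left hs] at h3
  linarith

/-! ### Uniqueness of the fundamental simplex up to isometry -/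

/-- The Gram matrix of `[3,4,4]` is nondegenerate. Its entries are read off from `standardNormal`,
which turns a linear relation into an explicit system in the coefficients. -/
theorem linearIndependent_of_gram {v : Fin 4 → Fin 4 → ℝ} (hv : ∀ i j,
    lorentzForm (v i) (v j) = -Real.cos (Real.pi / (coxeterMatrix344 i j : ℝ))) :
    LinearIndependent ℝ v := by
  rw [Fintype.linearIndependent_iff]
  intro c hc
  have key (j) : ∑ i, c i * lorentzForm (standardNormal i) (standardNormal j) = 0 := by
    have := congrArg (fun x => lorentzForm x (v j)) hc
    simpa [hv, gram_standardNormal] using this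
  have h := inv_sqrt_two_mul_self
  have k0 := key 0
  have k1 := key 1
  have k2 := key 2
  have k3 := key 3
  simp [Fin.sum_univ_four, lorentzForm_standardNormal_zero, lorentzForm_standardNormal_one,
    lorentzForm_standardNormal_two, lorentzForm_standardNormal_three] at k0 k1 k2 k3
  simp [standardNormal] at k0 k1 k2 k3
  have e0 : c 0 = c 1 / 2 := by linear_combination k0 - (2 * c 0 - c 1) * h
  have e1 : c 1 - c 0 / 2 = c 2 * (√2)⁻¹ := by linear_combination k1 - (2 * c 1 - c 0) * h
  have e3 : c 3 = c 2 * (√2)⁻¹ := by linear_combination k3 - 2 * c 3 * h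
  have e2 : c 1 / 2 + c 3 / 2 = c 2 * (√2)⁻¹ := by
    linear_combination (-(√2)⁻¹) * k2 - (c 1 + c 3) * h
  have z1 : c 1 = 0 := by linarith
  have z0 : c 0 = 0 := by linarith
  have z3 : c 3 = 0 := by linarith
  have z2 : c 2 = 0 := by simpa [z1, z3] using k2
  intro i
  fin_cases i
  exacts [z0, z1, z2, z3]

/-- Two bases with equal Gram matrices differ by a form-preserving map. The interior point settles
the sheet: its image satisfies the inequalities of the standard simplex, which force `x₄ > 0`. -/
theorem exists_isometry_to_standard {v : Fin 4 → Fin 4 → ℝ} (hv : IsFundamentalSimplex v) :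
    ∃ g ∈ orthochronousLorentzGroup, ∀ i, g (v i) = standardNormal i := by
  let b := basisOfLinearIndependentOfCardEqFinrank (linearIndependent_of_gram hv.gram) (by simp)
  let b' := basisOfLinearIndependentOfCardEqFinrank
    (linearIndependent_of_gram gram_standardNormal) (by simp)
  have hb (i) : b i = v i := by simp [b]
  have hb' (i) : b' i = standardNormal i := by simp [b']
  let g := b.equiv b' (Equiv.refl _)
  have hg (i) : g (v i) = standardNormal i := by
    rw [← hb, ← hb', Module.Basis.equiv_apply]; rfl
  have hform : ∀ x y, lorentzForm (g x) (g y) = lorentzForm x y := by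
    have : lorentzForm.compl₁₂ g.toLinearMap g.toLinearMap = lorentzForm := by
      refine LinearMap.BilinForm.ext_basis b fun i j => ?_
      simp [hb, hg, gram_standardNormal, hv.gram]
    intro x y
    exact congrFun (congrArg DFunLike.coe (congrFun (congrArg DFunLike.coe this) x)) y
  obtain ⟨x, hx, hpos⟩ := hv.interior_nonempty
  refine ⟨g, mem_orthochronousLorentzGroup hform hx ⟨(hform x x).trans hx.1, ?_⟩, hg⟩
  exact pos_of_mem_standard_cone fun i => by rw [← hg, hform]; exact hpos i

/-- Conjugation by `g` carries the reflections in the `v i` to those in the `w i`, and both sets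
generate `Γ₃`. The map `g` itself need not be integral. -/
theorem map_conj_Gamma3 {v w : Fin 4 → Fin 4 → ℝ} (hv : IsFundamentalSimplex v)
    (hw : IsFundamentalSimplex w) {g : (Fin 4 → ℝ) ≃ₗ[ℝ] (Fin 4 → ℝ)}
    (hg : g ∈ orthochronousLorentzGroup) (hgv : ∀ i, g (v i) = w i) :
    Gamma3.map (MulAut.conj g).toMonoidHom = Gamma3 := by
  have key {s : (Fin 4 → ℝ) ≃ₗ[ℝ] (Fin 4 → ℝ)} {i : Fin 4} :
      IsReflectionIn (g * s * g⁻¹) (w i) ↔ IsReflectionIn s (v i) := by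
    have hconj (x) : (g * s * g⁻¹) (g x) = g (s x) := by
      change g (s (g.symm (g x))) = _
      rw [g.symm_apply_apply]
    rw [IsReflectionIn, IsReflectionIn, g.surjective.forall]
    refine forall_congr' fun x => ?_
    rw [hconj, ← hgv, hg.1, ← map_smul, ← map_sub, g.injective.eq_iff]
  nth_rewrite 1 [← hv.generates]
  rw [MonoidHom.map_closure, ← hw.generates]
  congr 1
  ext s
  constructor
  · rintro ⟨s, ⟨i, hs⟩, rfl⟩
    exact ⟨i, key.2 hs⟩
  · rintro ⟨i, hs⟩
    have e : g * (g⁻¹ * s * g) * g⁻¹ = s := by group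
    exact ⟨g⁻¹ * s * g, ⟨i, key.1 (by rwa [e])⟩, e⟩

/-! ### Stabilizers -/

theorem map_gammaStab (S : Set (Fin 4 → ℝ)) :
    (gammaStab S).map Gamma3.subtype = MulAction.stabilizer _ S ⊓ Gamma3 := by
  rw [← Subgroup.subgroupOf_map_subtype]
  rfl

/-- The stabilizer in `Γ₃` of a set, as a group of linear maps. -/
noncomputable def gammaStabEquiv (S : Set (Fin 4 → ℝ)) : gammaStab S ≃*
    (MulAction.stabilizer ((Fin 4 → ℝ) ≃ₗ[ℝ] (Fin 4 → ℝ)) S ⊓ Gamma3 : Subgroup _) :=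
  ((gammaStab S).equivMapOfInjective _ Gamma3.subtype_injective).trans
    (MulEquiv.subgroupCongr (map_gammaStab S))

theorem smul_edgeGeodesic {v w : Fin 4 → Fin 4 → ℝ} {g : (Fin 4 → ℝ) ≃ₗ[ℝ] (Fin 4 → ℝ)}
    (hg : g ∈ orthochronousLorentzGroup) (hgv : ∀ i, g (v i) = w i) (i j : Fin 4) :
    g • edgeGeodesic v i j = edgeGeodesic w i j := by
  ext x
  obtain ⟨x, rfl⟩ := g.surjective x
  rw [show g x = g • x from rfl, Set.smul_mem_smul_set_iff]
  simp only [edgeGeodesic, hyperbolicPlane, Set.mem_inter_iff, Set.mem_ofPred_eq, ← hgv,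
    LinearEquiv.smul_def, hg.1, hg.2 x]

theorem nonempty_gammaStab_equiv_standard {v : Fin 4 → Fin 4 → ℝ} (hv : IsFundamentalSimplex v)
    (i j : Fin 4) :
    Nonempty (gammaStab (edgeGeodesic v i j) ≃* gammaStab (edgeGeodesic standardNormal i j)) := by
  obtain ⟨g, hg, hgv⟩ := exists_isometry_to_standard hv
  have e : (MulAction.stabilizer _ (edgeGeodesic v i j) ⊓ Gamma3).map (MulAut.conj g).toMonoidHom
      = MulAction.stabilizer _ (edgeGeodesic standardNormal i j) ⊓ Gamma3 := by
    rw [Subgroup.map_inf _ _ _ (MulAut.conj g).injective,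
      map_conj_Gamma3 hv isFundamentalSimplex_standardNormal hg hgv,
      ← MulAction.stabilizer_smul_eq_stabilizer_map_conj, smul_edgeGeodesic hg hgv]
  exact ⟨(gammaStabEquiv _).trans (((Subgroup.equivMapOfInjective _ _
    (MulAut.conj g).injective).trans (MulEquiv.subgroupCongr e)).trans (gammaStabEquiv _).symm)⟩

/-! ### Finite stabilizers -/

/-- The slice is bounded. Cauchy-Schwarz on the spatial parts gives `(k + y₄u₄)² ≤ (y₄² + e) q`. By
integrality `u₄² - q ≥ 1`, so `y₄²` is at most a linear function of `|y₄|`; the norm equation then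
bounds the other coordinates. -/
theorem finite_int_lorentz_slice (u : Fin 4 → ℤ)
    (hu : u 0 * u 0 + u 1 * u 1 + u 2 * u 2 - u 3 * u 3 < 0) (e k : ℤ) :
    {y : Fin 4 → ℤ | y 0 * y 0 + y 1 * y 1 + y 2 * y 2 - y 3 * y 3 = e ∧
      y 0 * u 0 + y 1 * u 1 + y 2 * u 2 - y 3 * u 3 = k}.Finite := by
  set q := u 0 * u 0 + u 1 * u 1 + u 2 * u 2 with hq
  have hq0 : 0 ≤ q := by
    have := mul_self_nonneg (u 0)
    have := mul_self_nonneg (u 1)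
    have := mul_self_nonneg (u 2)
    linarith
  set B := 2 * |k * u 3| + |e| * q + |e| with hB
  refine (Set.finite_Icc (fun _ : Fin 4 => -B) (fun _ => B)).subset ?_
  rintro y ⟨hy, hyu⟩
  have hcs : (y 0 * u 0 + y 1 * u 1 + y 2 * u 2) ^ 2 ≤
      (y 0 * y 0 + y 1 * y 1 + y 2 * y 2) * q := by
    nlinarith [sq_nonneg (y 0 * u 1 - y 1 * u 0), sq_nonneg (y 0 * u 2 - y 2 * u 0),
      sq_nonneg (y 1 * u 2 - y 2 * u 1)]
  have e1 : y 0 * u 0 + y 1 * u 1 + y 2 * u 2 = k + y 3 * u 3 := by linarith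
  have e2 : y 0 * y 0 + y 1 * y 1 + y 2 * y 2 = y 3 * y 3 + e := by linarith
  rw [e1, e2] at hcs
  have hn : y 3 * y 3 ≤ y 3 * y 3 * (u 3 * u 3 - q) :=
    le_mul_of_one_le_right (mul_self_nonneg _) (by linarith)
  have heq : e * q ≤ |e| * q := mul_le_mul_of_nonneg_right (le_abs_self e) hq0
  have hku : -(k * u 3 * y 3) ≤ |k * u 3| * |y 3| := by
    rw [← abs_mul]; exact neg_le_abs _
  have hquad : |y 3| * |y 3| ≤ |e| * q + 2 * |k * u 3| * |y 3| := by
    rw [abs_mul_abs_self]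
    nlinarith [mul_self_nonneg k]
  have hm : 0 ≤ |k * u 3| := abs_nonneg _
  have hen : 0 ≤ |e| * q := mul_nonneg (abs_nonneg _) hq0
  have hd : |y 3| ≤ 2 * |k * u 3| + |e| * q := by
    by_contra! hlt
    nlinarith
  have he : 0 ≤ |e| := abs_nonneg e
  have hbound (a : ℤ) (ha : a * a ≤ y 3 * y 3 + e) : |a| ≤ B := by
    have h1 : |e| ≤ |e| * |e| := by
      rcases he.eq_or_lt with h | h
      · rw [← h]; simp
      · exact le_mul_of_one_le_left he h
    have h2 : |a| ≤ |y 3| + |e| := by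
      refine abs_le_of_sq_le_sq' ?_ (by positivity) |>.2
      have := le_abs_self e
      have := mul_nonneg (abs_nonneg (y 3)) he
      nlinarith [abs_mul_abs_self a, abs_mul_abs_self (y 3)]
    linarith
  have h0 := mul_self_nonneg (y 0)
  have h1 := mul_self_nonneg (y 1)
  have h2 := mul_self_nonneg (y 2)
  have hb : ∀ i, |y i| ≤ B := by
    intro i
    fin_cases i
    exacts [hbound (y 0) (by linarith), hbound (y 1) (by linarith), hbound (y 2) (by linarith),
      hd.trans (by linarith)]
  exact ⟨fun i => (abs_le.1 (hb i)).1, fun i => (abs_le.1 (hb i)).2⟩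

/-- The inclusion of `ℤ⁴` in `ℝ⁴`. -/
def realVec (u : Fin 4 → ℤ) : Fin 4 → ℝ := fun i => (u i : ℝ)

theorem integralAction_realVec (A : Matrix.GeneralLinearGroup (Fin 4) ℤ) (u : Fin 4 → ℤ) :
    integralAction A (realVec u) = realVec (A.val.mulVec u) := by
  funext i
  rw [integralAction_apply_coord]
  simp [realVec, Matrix.mulVec, dotProduct, Fin.sum_univ_four]

theorem lorentzForm_realVec (u v : Fin 4 → ℤ) : lorentzForm (realVec u) (realVec v) =
    ((u 0 * v 0 + u 1 * v 1 + u 2 * v 2 - u 3 * v 3 : ℤ) : ℝ) := by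
  rw [lorentzForm_apply]
  simp [realVec]

/-- The stabilizer in `Γ₃` of an integral timelike vector is finite. -/
theorem finite_fixing_timelike {u : Fin 4 → ℤ} (hu : lorentzForm (realVec u) (realVec u) < 0) :
    {A ∈ integralLorentzGroup | integralAction A (realVec u) = realVec u}.Finite := by
  rw [lorentzForm_realVec] at hu
  have hfin : (Set.univ.pi fun j : Fin 4 => {y : Fin 4 → ℤ |
      y 0 * y 0 + y 1 * y 1 + y 2 * y 2 - y 3 * y 3 =
        (Matrix.diagonal ![1, 1, 1, -1] : Matrix (Fin 4) (Fin 4) ℤ) j j ∧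
      y 0 * u 0 + y 1 * u 1 + y 2 * u 2 - y 3 * u 3 =
        ![u 0, u 1, u 2, -u 3] j}).Finite :=
    Set.Finite.pi fun j => finite_int_lorentz_slice u (by exact_mod_cast hu) _ _
  -- If `A` fixes `u`, each column `A eⱼ` has the norm of `eⱼ` and the same product with `u` as
  -- `eⱼ`, so it lies in a finite slice.
  refine Set.Finite.of_finite_image (f := fun A j => A.val.col j) (hfin.subset ?_) ?_
  · rintro _ ⟨A, ⟨hA, hAu⟩, rfl⟩ j -
    refine ⟨column_orthonormal hA j j, ?_⟩
    have h := hA.1.1 (Pi.single j 1) (realVec u)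
    rw [hAu, lorentzForm_apply, lorentzForm_apply] at h
    simp only [integralAction_single, realVec] at h
    have h' : ((A.val 0 j * u 0 + A.val 1 j * u 1 + A.val 2 j * u 2 - A.val 3 j * u 3 : ℤ) : ℝ) =
        (![u 0, u 1, u 2, -u 3] j : ℤ) := by
      push_cast
      rw [h]
      fin_cases j <;> simp
    exact_mod_cast h'
  · intro A _ B _ h
    exact ext_col (congrFun h 0) (congrFun h 1) (congrFun h 2) (congrFun h 3)

theorem finite_gammaStab_of_fixes {S : Set (Fin 4 → ℝ)} {u : Fin 4 → ℤ}
    (hu : lorentzForm (realVec u) (realVec u) < 0)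
    (h : ∀ A ∈ integralLorentzGroup, (∀ x ∈ S, integralAction A x ∈ S) →
      integralAction A (realVec u) = realVec u) : Finite (gammaStab S) := by
  have hfin : Finite (MulAction.stabilizer ((Fin 4 → ℝ) ≃ₗ[ℝ] (Fin 4 → ℝ)) S ⊓ Gamma3 :
      Subgroup _) := by
    refine Set.Finite.subset ((finite_fixing_timelike hu).image integralAction) ?_
    rintro f ⟨hS, hf⟩
    obtain ⟨A, rfl⟩ := exists_integralAction_eq hf
    exact ⟨A, ⟨hf, h A hf fun x hx => (MulAction.mem_stabilizer_set.1 hS x).2 hx⟩, rfl⟩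
  exact Finite.of_equiv _ (gammaStabEquiv S).symm.toEquiv

/-- As `m` and `n` are lightlike, the norm of `t m + t⁻¹ n` is `2⟨m, n⟩ < 0` for every `t`, so
rescaling puts it on the hyperboloid. These points run along the geodesic with endpoints `m` and
`n`. -/
theorem smul_add_mem_hyperbolicSpace3 {m n : Fin 4 → ℤ}
    (hm : lorentzForm (realVec m) (realVec m) = 0) (hn : lorentzForm (realVec n) (realVec n) = 0)
    (hmn : lorentzForm (realVec m) (realVec n) < 0) (hm3 : 0 < m 3) (hn3 : 0 < n 3) {t : ℝ}
    (ht : 0 < t) : ∃ r : ℝ, 0 < r ∧ r • (t • realVec m + t⁻¹ • realVec n) ∈ hyperbolicSpace3 := by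
  set c := -(2 * lorentzForm (realVec m) (realVec n)) with hc
  have hc0 : 0 < c := by linarith
  have hs : (√c)⁻¹ * (√c)⁻¹ * c = 1 := by
    rw [← mul_inv, Real.mul_self_sqrt hc0.le, inv_mul_cancel₀ hc0.ne']
  have hpos : 0 < (√c)⁻¹ := by positivity
  have hnm : lorentzForm (realVec n) (realVec m) = lorentzForm (realVec m) (realVec n) := by
    rw [lorentzForm_apply, lorentzForm_apply]; ring
  refine ⟨(√c)⁻¹, hpos, ?_, ?_⟩
  · simp only [map_add, map_smul, LinearMap.add_apply, LinearMap.smul_apply, smul_eq_mul, hm, hn,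
      hnm]
    have htt : t * t⁻¹ = 1 := mul_inv_cancel₀ ht.ne'
    linear_combination (-t * t⁻¹) * hs - htt
  · have h1 : (0 : ℝ) < m 3 := by exact_mod_cast hm3
    have h2 : (0 : ℝ) < n 3 := by exact_mod_cast hn3
    simp only [Pi.smul_apply, Pi.add_apply, smul_eq_mul, realVec]
    positivity

/-- A unit coordinate is a convenient certificate of primitivity: it recovers `t` as an integer. -/
theorem int_of_smul_realVec {u v : Fin 4 → ℤ} {t : ℝ} (h : realVec u = t • realVec v) {i : Fin 4}
    (hi : IsUnit (v i)) : ∃ z : ℤ, t = z := by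
  have h' : (u i : ℝ) = t * v i := congrFun h i
  have hsq : (v i * v i : ℝ) = 1 := by exact_mod_cast Int.isUnit_mul_self hi
  exact ⟨u i * v i, by push_cast; rw [h', mul_assoc, hsq, mul_one]⟩

/-- Two integral lightlike vectors that are mapped to multiples of two others are mapped to these,
if no common factors prevent it. -/
theorem map_isotropic_eq {A : Matrix.GeneralLinearGroup (Fin 4) ℤ}
    (hA : A ∈ integralLorentzGroup) {m n m' n' : Fin 4 → ℤ}
    (hm : lorentzForm (realVec m) (realVec m) = 0) (hn : lorentzForm (realVec n) (realVec n) = 0)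
    (hmn : lorentzForm (realVec m) (realVec n) < 0) (hm3 : 0 < m 3) (hn3 : 0 < n 3)
    (hmn' : lorentzForm (realVec m') (realVec n') = lorentzForm (realVec m) (realVec n))
    (hm3' : 0 < m' 3) (hn3' : 0 < n' 3) {i j : Fin 4} (hi : IsUnit (m' i)) (hj : IsUnit (n' j))
    {a b : ℝ} (ha : integralAction A (realVec m) = a • realVec m')
    (hb : integralAction A (realVec n) = b • realVec n') :
    integralAction A (realVec m) = realVec m' ∧ integralAction A (realVec n) = realVec n' := by
  obtain ⟨z, rfl⟩ := int_of_smul_realVec ((integralAction_realVec A m).symm.trans ha) hi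
  obtain ⟨w, rfl⟩ := int_of_smul_realVec ((integralAction_realVec A n).symm.trans hb) hj
  have h := hA.1.1 (realVec m) (realVec n)
  rw [ha, hb, map_smul, map_smul, LinearMap.smul_apply, smul_eq_mul, smul_eq_mul, hmn',
    ← mul_assoc] at h
  have hzw : w * z = 1 := by
    have := mul_right_cancel₀ hmn.ne (h.trans (one_mul _).symm)
    exact_mod_cast this
  -- Now `z = w = ±1`. The sign `-1` would send a point of the upper sheet to one with negative last
  -- coordinate.
  obtain ⟨r, hr, hp⟩ := smul_add_mem_hyperbolicSpace3 hm hn hmn hm3 hn3 one_pos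
  have hfp := ((hA.1.2 _).2 hp).2
  rw [map_smul, map_add, map_smul, map_smul, ha, hb] at hfp
  simp only [Pi.smul_apply, Pi.add_apply, smul_eq_mul, realVec, inv_one, one_mul,
    mul_pos_iff_of_pos_left hr] at hfp
  rcases Int.mul_eq_one_iff_eq_one_or_neg_one.1 hzw with ⟨rfl, rfl⟩ | ⟨rfl, rfl⟩
  · simp [ha, hb]
  · have h1 : (0 : ℝ) < m' 3 := by exact_mod_cast hm3'
    have h2 : (0 : ℝ) < n' 3 := by exact_mod_cast hn3'
    push_cast at hfp
    linarith

/-- A geodesic with two rational ideal endpoints has a finite stabilizer in `Γ₃`. -/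
theorem finite_gammaStab_of_isotropic {S : Set (Fin 4 → ℝ)} (m n : Fin 4 → ℤ)
    (hm : lorentzForm (realVec m) (realVec m) = 0) (hn : lorentzForm (realVec n) (realVec n) = 0)
    (hmn : lorentzForm (realVec m) (realVec n) < 0) (hm3 : 0 < m 3) (hn3 : 0 < n 3)
    (i j : Fin 4) (hi : IsUnit (m i)) (hj : IsUnit (n j))
    (hS : ∀ x, x ∈ S ↔ x ∈ hyperbolicSpace3 ∧ ∃ a b : ℝ, x = a • realVec m + b • realVec n) :
    Finite (gammaStab S) := by
  have hadd : realVec (m + n) = realVec m + realVec n := by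
    funext i; simp [realVec]
  have hnm : lorentzForm (realVec n) (realVec m) = lorentzForm (realVec m) (realVec n) := by
    rw [lorentzForm_apply, lorentzForm_apply]; ring
  refine finite_gammaStab_of_fixes (u := m + n) ?_ fun A hA hAS => ?_
  · rw [hadd]
    simp only [map_add, LinearMap.add_apply, hm, hn, hnm]
    linarith
  have himage {t : ℝ} (ht : 0 < t) :
      ∃ a b : ℝ, integralAction A (t • realVec m + t⁻¹ • realVec n) =
        a • realVec m + b • realVec n := by
    obtain ⟨r, hr, hp⟩ := smul_add_mem_hyperbolicSpace3 hm hn hmn hm3 hn3 ht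
    obtain ⟨-, a, b, h⟩ := (hS _).1 (hAS _ ((hS _).2 ⟨hp, r * t, r * t⁻¹, by module⟩))
    refine ⟨r⁻¹ * a, r⁻¹ * b, ?_⟩
    rw [mul_smul, mul_smul, ← smul_add, ← h, map_smul, inv_smul_smul₀ hr.ne']
  -- The points for `t = 1` and `t = 2` span the plane of `m` and `n`: `m = (2/3)(2m + n/2) -
  -- (1/3)(m + n)` and `n = (4/3)(m + n) - (2/3)(2m + n/2)`.
  obtain ⟨a, b, h1⟩ := himage one_pos
  obtain ⟨c, d, h2⟩ := himage two_pos
  rw [map_add, map_smul, map_smul] at h1 h2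
  have hM : ∃ a b : ℝ, integralAction A (realVec m) = a • realVec m + b • realVec n :=
    ⟨(2 / 3) * c - a / 3, (2 / 3) * d - b / 3, by
      linear_combination (norm := module) (2 / 3 : ℝ) • h2 - (1 / 3 : ℝ) • h1⟩
  have hN : ∃ a b : ℝ, integralAction A (realVec n) = a • realVec m + b • realVec n :=
    ⟨(4 / 3) * a - (2 / 3) * c, (4 / 3) * b - (2 / 3) * d, by
      linear_combination (norm := module) (4 / 3 : ℝ) • h1 - (2 / 3 : ℝ) • h2⟩
  clear h1 h2 a b c d
  obtain ⟨a, b, hM⟩ := hM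
  obtain ⟨c, d, hN⟩ := hN
  have hMM := hA.1.1 (realVec m) (realVec m)
  have hNN := hA.1.1 (realVec n) (realVec n)
  have hMN := hA.1.1 (realVec m) (realVec n)
  rw [hM, hm] at hMM
  rw [hN, hn] at hNN
  rw [hM, hN] at hMN
  simp only [map_add, map_smul, LinearMap.add_apply, LinearMap.smul_apply, smul_eq_mul, hm, hn,
      hnm] at hMM hNN hMN
  -- The images of `m` and `n` are lightlike and the plane has only two lightlike lines, so `A`
  -- either preserves or swaps them. Both cases fix `m + n`.
  have hab : a * b = 0 := by
    have : a * b * lorentzForm (realVec m) (realVec n) = 0 := by linarith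
    exact (mul_eq_zero.1 this).resolve_right hmn.ne
  have hcd : c * d = 0 := by
    have : c * d * lorentzForm (realVec m) (realVec n) = 0 := by linarith
    exact (mul_eq_zero.1 this).resolve_right hmn.ne
  have habcd : a * d + b * c = 1 := by
    refine mul_right_cancel₀ hmn.ne ?_
    linarith
  rw [hadd, map_add]
  rcases mul_eq_zero.1 hab with rfl | rfl
  · have hd : d = 0 := by
      rcases mul_eq_zero.1 hcd with rfl | h
      · simp at habcd
      · exact h
    subst hd
    obtain ⟨e1, e2⟩ := map_isotropic_eq hA hm hn hmn hm3 hn3 hnm hn3 hm3 hj hi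
      (a := b) (b := c) (by simpa using hM) (by simpa using hN)
    rw [e1, e2, add_comm]
  · have hc : c = 0 := by
      rcases mul_eq_zero.1 hcd with h | rfl
      · exact h
      · simp at habcd
    subst hc
    obtain ⟨e1, e2⟩ := map_isotropic_eq hA hm hn hmn hm3 hn3 rfl hm3 hn3 hi hj
      (a := a) (b := d) (by simpa using hM) (by simpa using hN)
    rw [e1, e2]

theorem mem_edgeGeodesic_iff {v : Fin 4 → Fin 4 → ℝ} {i j : Fin 4} {x : Fin 4 → ℝ} :
    x ∈ edgeGeodesic v i j ↔
      x ∈ hyperbolicSpace3 ∧ lorentzForm x (v i) = 0 ∧ lorentzForm x (v j) = 0 := by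
  simp only [edgeGeodesic, hyperbolicPlane, Set.mem_inter_iff, Set.mem_ofPred_eq]
  tauto

theorem sqrt_two_inv_mul_eq_zero {x : ℝ} : (√2)⁻¹ * x = 0 ↔ x = 0 := by
  simp

/-- On the plane `(s, s, x, 2s + x)` the lightlike condition is `2s(s + 2x) = 0`, which has the two
rational solutions used here. -/
theorem finite_gammaStab_standard_zero_three :
    Finite (gammaStab (edgeGeodesic standardNormal 0 3)) := by
  refine finite_gammaStab_of_isotropic ![0, 0, 1, 1] ![2, 2, -1, 3]
    (by simp [lorentzForm_realVec]) (by simp [lorentzForm_realVec])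
    (by simp [lorentzForm_realVec]) (by decide) (by decide) 2 2 (by decide) (by decide)
    fun x => ?_
  rw [mem_edgeGeodesic_iff, lorentzForm_standardNormal_zero, lorentzForm_standardNormal_three,
    sqrt_two_inv_mul_eq_zero, sqrt_two_inv_mul_eq_zero]
  refine and_congr_right fun _ => ⟨fun ⟨h1, h2⟩ => ⟨x 2 + x 0 / 2, x 0 / 2, ?_⟩, ?_⟩
  · funext i
    fin_cases i <;> simp [realVec] <;> linarith
  · rintro ⟨a, b, rfl⟩
    constructor <;> simp [realVec]
    ring

theorem finite_gammaStab_standard_one_two :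
    Finite (gammaStab (edgeGeodesic standardNormal 1 2)) := by
  refine finite_gammaStab_of_isotropic ![1, 0, 0, 1] ![-1, 0, 0, 1]
    (by simp [lorentzForm_realVec]) (by simp [lorentzForm_realVec])
    (by simp [lorentzForm_realVec]) (by decide) (by decide) 3 3 (by decide) (by decide)
    fun x => ?_
  rw [mem_edgeGeodesic_iff, lorentzForm_standardNormal_one, lorentzForm_standardNormal_two,
    sqrt_two_inv_mul_eq_zero]
  refine and_congr_right fun _ => ⟨fun ⟨h1, h2⟩ => ⟨(x 3 + x 0) / 2, (x 3 - x 0) / 2, ?_⟩, ?_⟩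
  · funext i
    fin_cases i <;> simp [realVec] <;> linarith
  · rintro ⟨a, b, rfl⟩
    constructor <;> simp [realVec]

/-- On the plane `(x, s, s, x + 2s)` the lightlike condition is `2s(s + 2x) = 0`. -/
theorem finite_gammaStab_standard_one_three :
    Finite (gammaStab (edgeGeodesic standardNormal 1 3)) := by
  refine finite_gammaStab_of_isotropic ![1, 0, 0, 1] ![-1, 2, 2, 3]
    (by simp [lorentzForm_realVec]) (by simp [lorentzForm_realVec])
    (by simp [lorentzForm_realVec]) (by decide) (by decide) 3 0 (by decide) (by decide)
    fun x => ?_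
  rw [mem_edgeGeodesic_iff, lorentzForm_standardNormal_one, lorentzForm_standardNormal_three,
    sqrt_two_inv_mul_eq_zero, sqrt_two_inv_mul_eq_zero]
  refine and_congr_right fun _ => ⟨fun ⟨h1, h2⟩ => ⟨x 0 + x 1 / 2, x 1 / 2, ?_⟩, ?_⟩
  · funext i
    fin_cases i <;> simp [realVec] <;> linarith
  · rintro ⟨a, b, rfl⟩
    constructor <;> simp [realVec]
    ring

theorem finite_gammaStab_standard_two_three :
    Finite (gammaStab (edgeGeodesic standardNormal 2 3)) := by
  refine finite_gammaStab_of_isotropic ![1, 0, 0, 1] ![0, 1, 0, 1]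
    (by simp [lorentzForm_realVec]) (by simp [lorentzForm_realVec])
    (by simp [lorentzForm_realVec]) (by decide) (by decide) 3 3 (by decide) (by decide)
    fun x => ?_
  rw [mem_edgeGeodesic_iff, lorentzForm_standardNormal_two, lorentzForm_standardNormal_three,
    sqrt_two_inv_mul_eq_zero]
  refine and_congr_right fun _ => ⟨fun ⟨h1, h2⟩ => ⟨x 0, x 1, ?_⟩, ?_⟩
  · funext i
    fin_cases i <;> simp [realVec] <;> linarith
  · rintro ⟨a, b, rfl⟩
    constructor <;> simp [realVec]

/-! ### Infinite stabilizers -/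

namespace DihedralGroup

variable {G : Type*} [Group G]

/-- The bounded quantifiers make the hypotheses decidable for explicit integral matrices. -/
theorem lift_injective {n : ℕ} [NeZero n] {a b : G} (ha : a ^ n = 1) (hb : b * b = 1)
    (hab : a * b = b * a⁻¹) (h1 : ∀ k < n, a ^ k = 1 → k = 0) (h2 : ∀ k < n, b * a ^ k ≠ 1) :
    Function.Injective (lift n a b ha hb hab) := by
  rw [injective_iff_map_eq_one]
  have hval (i : ZMod n) : ((i.val : ℤ) : ZMod n) = i := by
    rw [Int.cast_natCast, ZMod.natCast_zmod_val]
  rintro (i | i) h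
  · rw [← hval i, lift_r_intCast, zpow_natCast] at h
    rw [(ZMod.val_eq_zero i).1 (h1 _ i.val_lt h), r_zero]
  · rw [← hval i, lift_sr_intCast, zpow_natCast] at h
    exact absurd h (h2 _ i.val_lt)

/-- Centralizers are subgroups, so commutation need only be checked on generators. -/
theorem commute_lift_lift {n m : ℕ} {a b c d : G} (ha : a ^ n = 1) (hb : b * b = 1)
    (hab : a * b = b * a⁻¹) (hc : c ^ m = 1) (hd : d * d = 1) (hcd : c * d = d * c⁻¹)
    (hac : a * c = c * a) (had : a * d = d * a) (hbc : b * c = c * b) (hbd : b * d = d * b)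
    (x : DihedralGroup n) (y : DihedralGroup m) :
    Commute (lift n a b ha hb hab x) (lift m c d hc hd hcd y) := by
  have h (z) (hza : a * z = z * a) (hzb : b * z = z * b) :
      z ∈ Subgroup.centralizer (Set.range (lift n a b ha hb hab)) := by
    rw [Subgroup.mem_centralizer_iff]
    rintro _ ⟨x, rfl⟩
    exact (Subgroup.mem_centralizer_singleton_iff.1
      (lift_mem (K := Subgroup.centralizer {z}) ha hb hab
        (Subgroup.mem_centralizer_singleton_iff.2 hza)
        (Subgroup.mem_centralizer_singleton_iff.2 hzb) x))
  exact Subgroup.mem_centralizer_iff.1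
    (lift_mem hc hd hcd (h c hac hbc) (h d had hbd) y) _ ⟨x, rfl⟩

end DihedralGroup

/-- The stabilizer in `Γ₃` of a set, as a group of integral matrices. -/
noncomputable def integralStabilizer (S : Set (Fin 4 → ℝ)) :
    Subgroup (Matrix.GeneralLinearGroup (Fin 4) ℤ) :=
  (MulAction.stabilizer ((Fin 4 → ℝ) ≃ₗ[ℝ] (Fin 4 → ℝ)) S ⊓ Gamma3).comap integralAction

theorem mem_integralStabilizer {S : Set (Fin 4 → ℝ)} {A : Matrix.GeneralLinearGroup (Fin 4) ℤ} :
    A ∈ integralStabilizer S ↔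
      A ∈ integralLorentzGroup ∧ ∀ x, integralAction A x ∈ S ↔ x ∈ S := by
  rw [integralStabilizer, Subgroup.mem_comap, Subgroup.mem_inf, and_comm,
    MulAction.mem_stabilizer_set]
  rfl

/-- Moves the computation to integral matrices, where the relations between the generators are
decidable. -/
theorem nonempty_gammaStab_equiv {D : Type*} [Group D] {S : Set (Fin 4 → ℝ)}
    (φ : D →* Matrix.GeneralLinearGroup (Fin 4) ℤ) (hφ : Function.Injective φ)
    (hrange : φ.range = integralStabilizer S) : Nonempty (gammaStab S ≃* D) := by
  have hmap : (integralStabilizer S).map integralAction =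
      MulAction.stabilizer ((Fin 4 → ℝ) ≃ₗ[ℝ] (Fin 4 → ℝ)) S ⊓ Gamma3 := by
    rw [integralStabilizer, Subgroup.map_comap_eq, inf_eq_right, ← integralGroup4_eq_range]
    exact inf_le_right.trans inf_le_right
  exact ⟨(((MonoidHom.ofInjective hφ).trans (MulEquiv.subgroupCongr hrange)).trans
    (((integralStabilizer S).equivMapOfInjective _ integralAction_injective).trans
    ((MulEquiv.subgroupCongr hmap).trans (gammaStabEquiv S).symm))).symm⟩

/-- The subgroup of matrices fixing a vector. -/
noncomputable def vectorStabilizer (u : Fin 4 → ℝ) :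
    Subgroup (Matrix.GeneralLinearGroup (Fin 4) ℤ) :=
  (MulAction.stabilizer ((Fin 4 → ℝ) ≃ₗ[ℝ] (Fin 4 → ℝ)) u).comap integralAction

theorem mem_vectorStabilizer {u : Fin 4 → ℝ} {A : Matrix.GeneralLinearGroup (Fin 4) ℤ} :
    A ∈ vectorStabilizer u ↔ integralAction A u = u := Iff.rfl

/-! #### The geodesic of the edge between the first and the third face -/

theorem mem_edgeGeodesic_zero_two {x : Fin 4 → ℝ} : x ∈ edgeGeodesic standardNormal 0 2 ↔
    x ∈ hyperbolicSpace3 ∧ x 0 = x 1 ∧ x 2 = 0 := by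
  rw [mem_edgeGeodesic_iff, lorentzForm_standardNormal_zero, lorentzForm_standardNormal_two,
    sqrt_two_inv_mul_eq_zero, sub_eq_zero]

theorem mem_integralStabilizer_zero_two {A : Matrix.GeneralLinearGroup (Fin 4) ℤ}
    (hA : A ∈ integralLorentzGroup) (h : ∀ x, (integralAction A x 0 = integralAction A x 1 ∧
      integralAction A x 2 = 0) ↔ (x 0 = x 1 ∧ x 2 = 0)) :
    A ∈ integralStabilizer (edgeGeodesic standardNormal 0 2) :=
  mem_integralStabilizer.2 ⟨hA, fun x => by
    rw [mem_edgeGeodesic_zero_two, mem_edgeGeodesic_zero_two, h, hA.1.2]⟩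

/-- The translation along the geodesic `x₁ = x₂`, `x₃ = 0`. -/
def translation02 : Matrix.GeneralLinearGroup (Fin 4) ℤ :=
  ⟨!![2, 1, 0, 2; 1, 2, 0, 2; 0, 0, 1, 0; 2, 2, 0, 3],
    !![2, 1, 0, -2; 1, 2, 0, -2; 0, 0, 1, 0; -2, -2, 0, 3], by decide +kernel, by decide +kernel⟩

/-- An isometry reversing the geodesic `x₁ = x₂`, `x₃ = 0`. -/
def reversal02 : Matrix.GeneralLinearGroup (Fin 4) ℤ :=
  ⟨!![0, -1, 0, 0; -1, 0, 0, 0; 0, 0, 1, 0; 0, 0, 0, 1],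
    !![0, -1, 0, 0; -1, 0, 0, 0; 0, 0, 1, 0; 0, 0, 0, 1], by decide +kernel, by decide +kernel⟩

theorem translation02_mem :
    translation02 ∈ integralStabilizer (edgeGeodesic standardNormal 0 2) := by
  refine mem_integralStabilizer_zero_two (mem_integralLorentzGroup (by decide +kernel)
    (by decide +kernel)) fun x => ?_
  simp only [integralAction_apply_coord]
  simp [translation02]
  intro _
  constructor <;> intro _ <;> linarith

theorem reversal02_mem : reversal02 ∈ integralStabilizer (edgeGeodesic standardNormal 0 2) := by
  refine mem_integralStabilizer_zero_two (mem_integralLorentzGroup (by decide +kernel)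
    (by decide +kernel)) fun x => ?_
  simp only [integralAction_apply_coord]
  simp [reversal02]
  intro _
  constructor <;> intro _ <;> linarith

theorem mirror_zero_mem02 : mirror 0 ∈ integralStabilizer (edgeGeodesic standardNormal 0 2) := by
  refine mem_integralStabilizer_zero_two (mirror_mem_integralLorentzGroup 0) fun x => ?_
  simp only [integralAction_apply_coord]
  simp [mirror, mirrorMatrix]
  intro _
  constructor <;> intro _ <;> linarith

theorem mirror_two_mem02 : mirror 2 ∈ integralStabilizer (edgeGeodesic standardNormal 0 2) := by
  refine mem_integralStabilizer_zero_two (mirror_mem_integralLorentzGroup 2) fun x => ?_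
  simp only [integralAction_apply_coord]
  simp [mirror, mirrorMatrix]

/-- The action of `D₂` on the orthogonal complement of the geodesic `x₁ = x₂`, `x₃ = 0`. -/
noncomputable def rotations02 : DihedralGroup 2 →* Matrix.GeneralLinearGroup (Fin 4) ℤ :=
  -- `D₂` is the Klein four-group, so one of the two commuting reflections can play the rotation.
  DihedralGroup.lift 2 (mirror 0) (mirror 2) (by decide +kernel) (by decide +kernel)
    (by decide +kernel)

/-- The action of `D_∞` on the geodesic `x₁ = x₂`, `x₃ = 0`. -/
noncomputable def motions02 : DihedralGroup 0 →* Matrix.GeneralLinearGroup (Fin 4) ℤ :=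
  DihedralGroup.lift 0 translation02 reversal02 (pow_zero _) (by decide +kernel)
    (by decide +kernel)

/-- `translation02` and `reversal02` are the identity on the orthogonal complement of the geodesic's
plane, while the two mirrors are the identity on that plane. -/
theorem commute02 (x y) : Commute (rotations02 x) (motions02 y) :=
  DihedralGroup.commute_lift_lift _ _ _ _ _ _ (by decide +kernel) (by decide +kernel)
    (by decide +kernel) (by decide +kernel) x y

/-- The action of `D₂ × D_∞` by isometries preserving the geodesic `x₁ = x₂`, `x₃ = 0`. -/
noncomputable def stabilizerHom02 :
    DihedralGroup 2 × DihedralGroup 0 →* Matrix.GeneralLinearGroup (Fin 4) ℤ :=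
  rotations02.noncommCoprod motions02 commute02

theorem stabilizerHom02_injective : Function.Injective stabilizerHom02 := by
  have h2 : √2 * √2 = (2 : ℝ) := Real.mul_self_sqrt (by norm_num)
  have hs : 0 < (√2 : ℝ) := by positivity
  -- The vector `(1, 1, 0, √2)` spans an ideal endpoint of the geodesic. The translation scales it
  -- by `3 + 2√2`, the mirrors fix it, and the reversal sends it to the other endpoint.
  refine DihedralGroup.noncommCoprod_lift_injective rotations02
    (DihedralGroup.lift_injective _ _ _ (by decide +kernel) (by decide +kernel)) _ _ _ commute02
    integralAction (u := ![1, 1, 0, √2]) (c := 3 + 2 * √2) ?_ (by linarith) ?_ ?_ ?_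
  · intro h
    simpa using congrFun h 0
  · funext i
    rw [integralAction_apply_coord]
    fin_cases i <;> simp [translation02] <;> linarith
  · intro t h
    have e0 := congrFun h 0
    have e3 := congrFun h 3
    rw [integralAction_apply_coord] at e0 e3
    simp [reversal02] at e0 e3
    rcases e3 with e3 | e3
    all_goals linarith
  · intro x
    rw [← mem_vectorStabilizer]
    refine DihedralGroup.lift_mem _ _ _ ?_ ?_ x <;> rw [mem_vectorStabilizer] <;> funext i <;>
      rw [integralAction_apply_coord] <;> fin_cases i <;> simp [mirror, mirrorMatrix]

theorem stabilizerHom02_range_le :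
    stabilizerHom02.range ≤ integralStabilizer (edgeGeodesic standardNormal 0 2) := by
  rintro _ ⟨⟨x, y⟩, rfl⟩
  exact mul_mem (DihedralGroup.lift_mem _ _ _ mirror_zero_mem02 mirror_two_mem02 x)
    (DihedralGroup.lift_mem _ _ _ translation02_mem reversal02_mem y)

theorem mem_range_noncommCoprod_left {G H K : Type*} [Group G] [Group H] [Group K] {f : G →* K}
    {g : H →* K} (h : ∀ x y, Commute (f x) (g y)) (x : G) : f x ∈ (f.noncommCoprod g h).range :=
  ⟨(x, 1), by simp⟩

theorem mem_range_noncommCoprod_right {G H K : Type*} [Group G] [Group H] [Group K] {f : G →* K}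
    {g : H →* K} (h : ∀ x y, Commute (f x) (g y)) (y : H) : g y ∈ (f.noncommCoprod g h).range :=
  ⟨(1, y), by simp⟩

theorem mirror_zero_mem_range02 : mirror 0 ∈ stabilizerHom02.range := by
  rw [show mirror 0 = rotations02 (.r 1) from (DihedralGroup.lift_r_one _ _ _).symm]
  exact mem_range_noncommCoprod_left commute02 _

theorem mirror_two_mem_range02 : mirror 2 ∈ stabilizerHom02.range := by
  rw [show mirror 2 = rotations02 (.sr 0) from (DihedralGroup.lift_sr_zero _ _ _).symm]
  exact mem_range_noncommCoprod_left commute02 _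

theorem translation02_mem_range : translation02 ∈ stabilizerHom02.range := by
  rw [show translation02 = motions02 (.r 1) from (DihedralGroup.lift_r_one _ _ _).symm]
  exact mem_range_noncommCoprod_right commute02 _

theorem reversal02_mem_range : reversal02 ∈ stabilizerHom02.range := by
  rw [show reversal02 = motions02 (.sr 0) from (DihedralGroup.lift_sr_zero _ _ _).symm]
  exact mem_range_noncommCoprod_right commute02 _

theorem last_column02 {A : Matrix.GeneralLinearGroup (Fin 4) ℤ}
    (hA : A ∈ integralStabilizer (edgeGeodesic standardNormal 0 2)) :
    A.val 0 3 = A.val 1 3 ∧ A.val 2 3 = 0 := by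
  have h := ((mem_integralStabilizer.1 hA).2 (Pi.single 3 1)).2
    (mem_edgeGeodesic_zero_two.2 ⟨single_three_mem_hyperbolicSpace3, by simp, by simp⟩)
  obtain ⟨-, h1, h2⟩ := mem_edgeGeodesic_zero_two.1 h
  rw [integralAction_single] at h1 h2
  rw [integralAction_single] at h1
  exact ⟨by exact_mod_cast h1, by exact_mod_cast h2⟩

/-- Tests a second point of the geodesic, where `√3` normalizes `(1, 1, 0, ·)`. The contribution of
the last column drops out by `last_column02`. -/
theorem columns02 {A : Matrix.GeneralLinearGroup (Fin 4) ℤ}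
    (hA : A ∈ integralStabilizer (edgeGeodesic standardNormal 0 2)) :
    A.val 0 0 + A.val 0 1 = A.val 1 0 + A.val 1 1 ∧ A.val 2 0 + A.val 2 1 = 0 := by
  obtain ⟨c1, c2⟩ := last_column02 hA
  have h := ((mem_integralStabilizer.1 hA).2 ![1, 1, 0, √3]).2
    (mem_edgeGeodesic_zero_two.2 ⟨mem_hyperbolicSpace3.2
      ⟨by simp; norm_num, by simp⟩, by simp, by simp⟩)
  obtain ⟨-, h1, h2⟩ := mem_edgeGeodesic_zero_two.1 h
  rw [integralAction_apply_coord] at h1 h2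
  rw [integralAction_apply_coord] at h1
  simp [c1, c2] at h1 h2
  exact ⟨by exact_mod_cast h1, by exact_mod_cast h2⟩

theorem mem_range02_of_fixes_two {A : Matrix.GeneralLinearGroup (Fin 4) ℤ}
    (hA : A ∈ integralStabilizer (edgeGeodesic standardNormal 0 2))
    (h3 : A.val.col 3 = ![0, 0, 0, 1]) (h0 : A.val.col 0 = ![1, 0, 0, 0]) :
    A ∈ stabilizerHom02.range := by
  have hL := (mem_integralStabilizer.1 hA).1
  obtain ⟨r1, r2⟩ := columns02 hA
  have o01 := column_orthonormal hL 0 1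
  have o02 := column_orthonormal hL 0 2
  have o12 := column_orthonormal hL 1 2
  have c0 (i) : A.val i 0 = _ := congrFun h0 i
  have c (v : Fin 4 → ℤ) (j i) (h : A.val.col j = v) : A.val i j = v i := congrFun h i
  simp [c0] at o01 o02 r1 r2
  have h1 : A.val.col 1 = ![0, 1, 0, 0] := by
    rcases unit_column hL h3 (j := 1) (by decide) with h | h | h | h | h | h <;>
      simp [c _ _ _ h] at o01 r1 r2 ⊢
    exact h
  rcases unit_column hL h3 (j := 2) (by decide) with h | h | h | h | h | h
  · simp [c _ _ _ h] at o02
  · simp [c _ _ _ h] at o02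
  · simp [c _ _ _ h, c _ _ _ h1] at o12
  · simp [c _ _ _ h, c _ _ _ h1] at o12
  · convert stabilizerHom02.range.one_mem
    exact ext_col (h0.trans (by decide +kernel)) (h1.trans (by decide +kernel))
      (h.trans (by decide +kernel)) (h3.trans (by decide +kernel))
  · convert mirror_two_mem_range02
    exact ext_col (h0.trans (by decide +kernel)) (h1.trans (by decide +kernel))
      (h.trans (by decide +kernel)) (h3.trans (by decide +kernel))

theorem mem_range02_of_fixes_origin {A : Matrix.GeneralLinearGroup (Fin 4) ℤ}
    (hA : A ∈ integralStabilizer (edgeGeodesic standardNormal 0 2))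
    (h3 : A.val.col 3 = ![0, 0, 0, 1]) : A ∈ stabilizerHom02.range := by
  have hL := (mem_integralStabilizer.1 hA).1
  have step {S : Matrix.GeneralLinearGroup (Fin 4) ℤ} (hS : S ∈ stabilizerHom02.range)
      (e3 : S.val.mulVec ![0, 0, 0, 1] = ![0, 0, 0, 1])
      (e0 : S.val.mulVec (A.val.col 0) = ![1, 0, 0, 0]) : A ∈ stabilizerHom02.range := by
    refine (stabilizerHom02.range.mul_mem_cancel_left hS).1
      (mem_range02_of_fixes_two (mul_mem (stabilizerHom02_range_le hS) hA) ?_ ?_)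
    · rw [col_mul, h3, e3]
    · rw [col_mul, e0]
  have m0 := mirror_zero_mem_range02
  have mr := reversal02_mem_range
  obtain ⟨-, r2⟩ := columns02 hA
  have o01 := column_orthonormal hL 0 1
  have c3 (j : Fin 4) (hj : j ≠ 3) : A.val 3 j = 0 := by
    rcases unit_column hL h3 hj with h | h | h | h | h | h <;> exact congrFun h 3
  have c (v : Fin 4 → ℤ) (i) (h : A.val.col 0 = v) : A.val i 0 = v i := congrFun h i
  rcases unit_column hL h3 (j := 0) (by decide) with h | h | h | h | h | h
  · exact mem_range02_of_fixes_two hA h3 h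
  · exact step (mul_mem mr m0) (by decide +kernel) (h ▸ by decide +kernel)
  · exact step m0 (by decide +kernel) (h ▸ by decide +kernel)
  · exact step mr (by decide +kernel) (h ▸ by decide +kernel)
  all_goals
    simp [c _ _ h] at o01 r2
    omega

/-- The last column of `A` is `(s, s, 0, d)` with `d² = 2s² + 1`. If `s ≠ 0`, then `d < 2|s|`, so
the translation or its inverse lowers `d` to `3d - 4|s| < d`. If `s = 0`, then `A` fixes `(0, 0, 0,
1)`. -/
theorem stabilizerHom02_range :
    stabilizerHom02.range = integralStabilizer (edgeGeodesic standardNormal 0 2) := by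
  refine le_antisymm stabilizerHom02_range_le fun A hA => ?_
  suffices H : ∀ (n : ℕ) (A), A ∈ integralStabilizer (edgeGeodesic standardNormal 0 2) →
      A.val 3 3 ≤ n → A ∈ stabilizerHom02.range from H (A.val 3 3).toNat A hA (Int.self_le_toNat _)
  clear hA A
  intro n
  induction n with
  | zero =>
    intro A hA hn
    exact absurd (corner_pos (mem_integralStabilizer.1 hA).1) (not_lt.2 hn)
  | succ n ih =>
    intro A hA hn
    have hL := (mem_integralStabilizer.1 hA).1
    have hpos := corner_pos hL
    obtain ⟨h1, h2⟩ := last_column02 hA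
    have hq := column_orthonormal hL 3 3
    rw [show (Matrix.diagonal ![1, 1, 1, -1] : Matrix (Fin 4) (Fin 4) ℤ) 3 3 = -1 by decide, h1,
      h2] at hq
    push_cast at hn
    rcases lt_trichotomy (A.val 1 3) 0 with hs | hs | hs
    · refine (stabilizerHom02.range.mul_mem_cancel_left translation02_mem_range).1
        (ih _ (mul_mem translation02_mem hA) ?_)
      have : (translation02 * A).val 3 3 = 2 * A.val 0 3 + 2 * A.val 1 3 + 3 * A.val 3 3 := by
        rw [Units.val_mul, Matrix.mul_apply, Fin.sum_univ_four]
        simp [translation02]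
      have : A.val 3 3 < -2 * A.val 1 3 := by nlinarith
      linarith
    · refine mem_range02_of_fixes_origin hA ?_
      rw [hs] at hq h1
      have h3 : A.val 3 3 = 1 := by nlinarith
      funext i
      fin_cases i
      exacts [h1, hs, h2, h3]
    · refine (stabilizerHom02.range.mul_mem_cancel_left
        (inv_mem translation02_mem_range)).1 (ih _ (mul_mem (inv_mem translation02_mem) hA) ?_)
      have : (translation02⁻¹ * A).val 3 3 =
          -2 * A.val 0 3 + -2 * A.val 1 3 + 3 * A.val 3 3 := by
        rw [Units.val_mul, Matrix.mul_apply, Fin.sum_univ_four, translation02, Units.inv_mk]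
        simp
      have : A.val 3 3 < 2 * A.val 1 3 := by nlinarith
      linarith

theorem nonempty_gammaStab_standard_zero_two :
    Nonempty (gammaStab (edgeGeodesic standardNormal 0 2) ≃*
      DihedralGroup 2 × DihedralGroup 0) :=
  nonempty_gammaStab_equiv stabilizerHom02 stabilizerHom02_injective stabilizerHom02_range

/-! #### The geodesic of the edge between the first and the second face -/

theorem mem_edgeGeodesic_zero_one {x : Fin 4 → ℝ} : x ∈ edgeGeodesic standardNormal 0 1 ↔
    x ∈ hyperbolicSpace3 ∧ x 0 = x 1 ∧ x 1 = x 2 := by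
  rw [mem_edgeGeodesic_iff, lorentzForm_standardNormal_zero, lorentzForm_standardNormal_one,
    sqrt_two_inv_mul_eq_zero, sqrt_two_inv_mul_eq_zero, sub_eq_zero, sub_eq_zero]

theorem mem_integralStabilizer_zero_one {A : Matrix.GeneralLinearGroup (Fin 4) ℤ}
    (hA : A ∈ integralLorentzGroup) (h : ∀ x, (integralAction A x 0 = integralAction A x 1 ∧
      integralAction A x 1 = integralAction A x 2) ↔ (x 0 = x 1 ∧ x 1 = x 2)) :
    A ∈ integralStabilizer (edgeGeodesic standardNormal 0 1) :=
  mem_integralStabilizer.2 ⟨hA, fun x => by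
    rw [mem_edgeGeodesic_zero_one, mem_edgeGeodesic_zero_one, h, hA.1.2]⟩

/-- A screw motion along the geodesic `x₁ = x₂ = x₃`, with half-turns as rotation part. -/
def translation01 : Matrix.GeneralLinearGroup (Fin 4) ℤ :=
  ⟨!![0, 1, 1, 1; 1, 0, 1, 1; 1, 1, 0, 1; 1, 1, 1, 2],
    !![0, 1, 1, -1; 1, 0, 1, -1; 1, 1, 0, -1; -1, -1, -1, 2], by decide +kernel,
    by decide +kernel⟩

/-- The point reflection in `(0, 0, 0, 1)`, which reverses the geodesic `x₁ = x₂ = x₃`. -/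
def reversal01 : Matrix.GeneralLinearGroup (Fin 4) ℤ :=
  ⟨!![-1, 0, 0, 0; 0, -1, 0, 0; 0, 0, -1, 0; 0, 0, 0, 1],
    !![-1, 0, 0, 0; 0, -1, 0, 0; 0, 0, -1, 0; 0, 0, 0, 1], by decide +kernel, by decide +kernel⟩

theorem translation01_mem :
    translation01 ∈ integralStabilizer (edgeGeodesic standardNormal 0 1) := by
  refine mem_integralStabilizer_zero_one (mem_integralLorentzGroup (by decide +kernel)
    (by decide +kernel)) fun x => ?_
  simp only [integralAction_apply_coord]
  simp [translation01]
  constructor <;> rintro ⟨h1, h2⟩ <;> constructor <;> linarith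

theorem reversal01_mem : reversal01 ∈ integralStabilizer (edgeGeodesic standardNormal 0 1) := by
  refine mem_integralStabilizer_zero_one (mem_integralLorentzGroup (by decide +kernel)
    (by decide +kernel)) fun x => ?_
  simp only [integralAction_apply_coord]
  simp [reversal01]

theorem mirror_zero_mem01 : mirror 0 ∈ integralStabilizer (edgeGeodesic standardNormal 0 1) := by
  refine mem_integralStabilizer_zero_one (mirror_mem_integralLorentzGroup 0) fun x => ?_
  simp only [integralAction_apply_coord]
  simp [mirror, mirrorMatrix]
  constructor <;> rintro ⟨h1, h2⟩ <;> constructor <;> linarith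

theorem mirror_one_mem01 : mirror 1 ∈ integralStabilizer (edgeGeodesic standardNormal 0 1) := by
  refine mem_integralStabilizer_zero_one (mirror_mem_integralLorentzGroup 1) fun x => ?_
  simp only [integralAction_apply_coord]
  simp [mirror, mirrorMatrix]
  constructor <;> rintro ⟨h1, h2⟩ <;> constructor <;> linarith

/-- The action of `D₃` on the orthogonal complement of the geodesic `x₁ = x₂ = x₃`. -/
noncomputable def rotations01 : DihedralGroup 3 →* Matrix.GeneralLinearGroup (Fin 4) ℤ :=
  DihedralGroup.lift 3 (mirror 0 * mirror 1) (mirror 0) (by decide +kernel) (by decide +kernel)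
    (by decide +kernel)

/-- The action of `D_∞` on the geodesic `x₁ = x₂ = x₃`. -/
noncomputable def motions01 : DihedralGroup 0 →* Matrix.GeneralLinearGroup (Fin 4) ℤ :=
  DihedralGroup.lift 0 translation01 reversal01 (pow_zero _) (by decide +kernel)
    (by decide +kernel)

/-- On the orthogonal complement of the geodesic's plane, `translation01` and `reversal01` both act
as `-1`, which is central. -/
theorem commute01 (x y) : Commute (rotations01 x) (motions01 y) :=
  DihedralGroup.commute_lift_lift _ _ _ _ _ _ (by decide +kernel) (by decide +kernel)
    (by decide +kernel) (by decide +kernel) x y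

/-- The action of `D₃ × D_∞` by isometries preserving the geodesic `x₁ = x₂ = x₃`. -/
noncomputable def stabilizerHom01 :
    DihedralGroup 3 × DihedralGroup 0 →* Matrix.GeneralLinearGroup (Fin 4) ℤ :=
  rotations01.noncommCoprod motions01 commute01

theorem stabilizerHom01_injective : Function.Injective stabilizerHom01 := by
  have h3 : √3 * √3 = (3 : ℝ) := Real.mul_self_sqrt (by norm_num)
  have hs : 0 < (√3 : ℝ) := by positivity
  have hmirror {i : Fin 4} (hi : i = 0 ∨ i = 1) : mirror i ∈ vectorStabilizer ![1, 1, 1, √3] := by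
    rw [mem_vectorStabilizer]
    funext j
    rw [integralAction_apply_coord]
    rcases hi with rfl | rfl <;> fin_cases j <;> simp [mirror, mirrorMatrix]
  -- Again the vector spans an ideal endpoint; the translation scales it by `2 + √3`.
  refine DihedralGroup.noncommCoprod_lift_injective rotations01
    (DihedralGroup.lift_injective _ _ _ (by decide +kernel) (by decide +kernel)) _ _ _ commute01
    integralAction (u := ![1, 1, 1, √3]) (c := 2 + √3) ?_ (by linarith) ?_ ?_ ?_
  · intro h
    simpa using congrFun h 0
  · funext i
    rw [integralAction_apply_coord]
    fin_cases i <;> simp [translation01] <;> linarith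
  · intro t h
    have e0 := congrFun h 0
    have e3 := congrFun h 3
    rw [integralAction_apply_coord] at e0 e3
    simp [reversal01] at e0 e3
    rcases e3 with e3 | e3
    all_goals linarith
  · intro x
    rw [← mem_vectorStabilizer]
    exact DihedralGroup.lift_mem _ _ _ (mul_mem (hmirror (.inl rfl)) (hmirror (.inr rfl)))
      (hmirror (.inl rfl)) x

theorem stabilizerHom01_range_le :
    stabilizerHom01.range ≤ integralStabilizer (edgeGeodesic standardNormal 0 1) := by
  rintro _ ⟨⟨x, y⟩, rfl⟩
  exact mul_mem (DihedralGroup.lift_mem _ _ _ (mul_mem mirror_zero_mem01 mirror_one_mem01)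
    mirror_zero_mem01 x) (DihedralGroup.lift_mem _ _ _ translation01_mem reversal01_mem y)

theorem mirror_zero_mem_range01 : mirror 0 ∈ stabilizerHom01.range := by
  rw [show mirror 0 = rotations01 (.sr 0) from (DihedralGroup.lift_sr_zero _ _ _).symm]
  exact mem_range_noncommCoprod_left commute01 _

theorem mirror_one_mem_range01 : mirror 1 ∈ stabilizerHom01.range := by
  refine (stabilizerHom01.range.mul_mem_cancel_left mirror_zero_mem_range01).1 ?_
  rw [show mirror 0 * mirror 1 = rotations01 (.r 1) from (DihedralGroup.lift_r_one _ _ _).symm]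
  exact mem_range_noncommCoprod_left commute01 _

theorem translation01_mem_range : translation01 ∈ stabilizerHom01.range := by
  rw [show translation01 = motions01 (.r 1) from (DihedralGroup.lift_r_one _ _ _).symm]
  exact mem_range_noncommCoprod_right commute01 _

theorem reversal01_mem_range : reversal01 ∈ stabilizerHom01.range := by
  rw [show reversal01 = motions01 (.sr 0) from (DihedralGroup.lift_sr_zero _ _ _).symm]
  exact mem_range_noncommCoprod_right commute01 _

theorem last_column01 {A : Matrix.GeneralLinearGroup (Fin 4) ℤ}
    (hA : A ∈ integralStabilizer (edgeGeodesic standardNormal 0 1)) :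
    A.val 0 3 = A.val 1 3 ∧ A.val 1 3 = A.val 2 3 := by
  have h := ((mem_integralStabilizer.1 hA).2 (Pi.single 3 1)).2
    (mem_edgeGeodesic_zero_one.2 ⟨single_three_mem_hyperbolicSpace3, by simp, by simp⟩)
  obtain ⟨-, h1, h2⟩ := mem_edgeGeodesic_zero_one.1 h
  simp only [integralAction_single] at h1 h2
  exact ⟨by exact_mod_cast h1, by exact_mod_cast h2⟩

theorem columns01 {A : Matrix.GeneralLinearGroup (Fin 4) ℤ}
    (hA : A ∈ integralStabilizer (edgeGeodesic standardNormal 0 1)) :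
    A.val 0 0 + A.val 0 1 + A.val 0 2 = A.val 1 0 + A.val 1 1 + A.val 1 2 ∧
      A.val 1 0 + A.val 1 1 + A.val 1 2 = A.val 2 0 + A.val 2 1 + A.val 2 2 := by
  obtain ⟨c1, c2⟩ := last_column01 hA
  have h := ((mem_integralStabilizer.1 hA).2 ![1, 1, 1, 2]).2
    (mem_edgeGeodesic_zero_one.2 ⟨mem_hyperbolicSpace3.2
      ⟨by simp; norm_num, by simp⟩, by simp, by simp⟩)
  obtain ⟨-, h1, h2⟩ := mem_edgeGeodesic_zero_one.1 h
  simp only [integralAction_apply_coord] at h1 h2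
  simp [c1, c2] at h1 h2
  exact ⟨by exact_mod_cast h1, by exact_mod_cast h2⟩

theorem mem_range01_of_fixes_two {A : Matrix.GeneralLinearGroup (Fin 4) ℤ}
    (hA : A ∈ integralStabilizer (edgeGeodesic standardNormal 0 1))
    (h3 : A.val.col 3 = ![0, 0, 0, 1]) (h0 : A.val.col 0 = ![1, 0, 0, 0]) :
    A ∈ stabilizerHom01.range := by
  have hL := (mem_integralStabilizer.1 hA).1
  obtain ⟨r1, r2⟩ := columns01 hA
  have o01 := column_orthonormal hL 0 1
  have o02 := column_orthonormal hL 0 2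
  have c (v : Fin 4 → ℤ) (j i) (h : A.val.col j = v) : A.val i j = v i := congrFun h i
  simp [c _ _ _ h0] at o01 o02 r1 r2
  have close {B : Matrix.GeneralLinearGroup (Fin 4) ℤ} (hB : B ∈ stabilizerHom01.range)
      (e0 : ![1, 0, 0, 0] = B.val.col 0) (e1 : A.val.col 1 = B.val.col 1)
      (e2 : A.val.col 2 = B.val.col 2) (e3 : ![0, 0, 0, 1] = B.val.col 3) :
      A ∈ stabilizerHom01.range := by
    rwa [ext_col (h0.trans e0) e1 e2 (h3.trans e3)]
  -- Orthogonality to the first column and equality of the row sums leave only the two orders of the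
  -- second and third basis vectors.
  rcases unit_column hL h3 (j := 1) (by decide) with h | h | h | h | h | h <;>
    rcases unit_column hL h3 (j := 2) (by decide) with h' | h' | h' | h' | h' | h' <;>
    simp [c _ _ _ h, c _ _ _ h'] at o01 o02 r1 r2
  · exact close (one_mem _) (by decide +kernel) (h.trans (by decide +kernel))
      (h'.trans (by decide +kernel)) (by decide +kernel)
  · exact close mirror_one_mem_range01 (by decide +kernel) (h.trans (by decide +kernel))
      (h'.trans (by decide +kernel)) (by decide +kernel)

theorem mem_range01_of_fixes_origin {A : Matrix.GeneralLinearGroup (Fin 4) ℤ}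
    (hA : A ∈ integralStabilizer (edgeGeodesic standardNormal 0 1))
    (h3 : A.val.col 3 = ![0, 0, 0, 1]) : A ∈ stabilizerHom01.range := by
  have hL := (mem_integralStabilizer.1 hA).1
  have step {S : Matrix.GeneralLinearGroup (Fin 4) ℤ} (hS : S ∈ stabilizerHom01.range)
      (e3 : S.val.mulVec ![0, 0, 0, 1] = ![0, 0, 0, 1])
      (e0 : S.val.mulVec (A.val.col 0) = ![1, 0, 0, 0]) : A ∈ stabilizerHom01.range := by
    refine (stabilizerHom01.range.mul_mem_cancel_left hS).1
      (mem_range01_of_fixes_two (mul_mem (stabilizerHom01_range_le hS) hA) ?_ ?_)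
    · rw [col_mul, h3, e3]
    · rw [col_mul, e0]
  have m0 := mirror_zero_mem_range01
  have m1 := mirror_one_mem_range01
  have mr := reversal01_mem_range
  rcases unit_column hL h3 (j := 0) (by decide) with h | h | h | h | h | h
  · exact mem_range01_of_fixes_two hA h3 h
  · exact step mr (by decide +kernel) (h ▸ by decide +kernel)
  · exact step m0 (by decide +kernel) (h ▸ by decide +kernel)
  · exact step (mul_mem m0 mr) (by decide +kernel) (h ▸ by decide +kernel)
  · exact step (mul_mem m0 m1) (by decide +kernel) (h ▸ by decide +kernel)
  · exact step (mul_mem (mul_mem m0 m1) mr) (by decide +kernel) (h ▸ by decide +kernel)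

/-- The descent now uses a last column `(s, s, s, d)` with `d² = 3s² + 1`. For `s ≠ 0` one has `d <
3|s|`, and the corner drops to `2d - 3|s| < d`. -/
theorem stabilizerHom01_range :
    stabilizerHom01.range = integralStabilizer (edgeGeodesic standardNormal 0 1) := by
  refine le_antisymm stabilizerHom01_range_le fun A hA => ?_
  suffices H : ∀ (n : ℕ) (A), A ∈ integralStabilizer (edgeGeodesic standardNormal 0 1) →
      A.val 3 3 ≤ n → A ∈ stabilizerHom01.range from H (A.val 3 3).toNat A hA (Int.self_le_toNat _)
  clear hA A
  intro n
  induction n with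
  | zero =>
    intro A hA hn
    exact absurd (corner_pos (mem_integralStabilizer.1 hA).1) (not_lt.2 hn)
  | succ n ih =>
    intro A hA hn
    have hL := (mem_integralStabilizer.1 hA).1
    have hpos := corner_pos hL
    obtain ⟨h1, h2⟩ := last_column01 hA
    have hq := column_orthonormal hL 3 3
    rw [show (Matrix.diagonal ![1, 1, 1, -1] : Matrix (Fin 4) (Fin 4) ℤ) 3 3 = -1 by decide, h1,
      ← h2] at hq
    push_cast at hn
    rcases lt_trichotomy (A.val 1 3) 0 with hs | hs | hs
    · refine (stabilizerHom01.range.mul_mem_cancel_left translation01_mem_range).1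
        (ih _ (mul_mem translation01_mem hA) ?_)
      have : (translation01 * A).val 3 3 =
          A.val 0 3 + A.val 1 3 + A.val 2 3 + 2 * A.val 3 3 := by
        rw [Units.val_mul, Matrix.mul_apply, Fin.sum_univ_four]
        simp [translation01]
      have : A.val 3 3 < -3 * A.val 1 3 := by nlinarith
      linarith
    · refine mem_range01_of_fixes_origin hA ?_
      rw [hs] at hq h1 h2
      have h3 : A.val 3 3 = 1 := by nlinarith
      funext i
      fin_cases i
      exacts [h1, hs, h2.symm, h3]
    · refine (stabilizerHom01.range.mul_mem_cancel_left
        (inv_mem translation01_mem_range)).1 (ih _ (mul_mem (inv_mem translation01_mem) hA) ?_)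
      have : (translation01⁻¹ * A).val 3 3 =
          -A.val 0 3 + -A.val 1 3 + -A.val 2 3 + 2 * A.val 3 3 := by
        rw [Units.val_mul, Matrix.mul_apply, Fin.sum_univ_four, translation01, Units.inv_mk]
        simp
      have : A.val 3 3 < 3 * A.val 1 3 := by nlinarith
      linarith

theorem nonempty_gammaStab_standard_zero_one :
    Nonempty (gammaStab (edgeGeodesic standardNormal 0 1) ≃*
      DihedralGroup 3 × DihedralGroup 0) :=
  nonempty_gammaStab_equiv stabilizerHom01 stabilizerHom01_injective stabilizerHom01_range

theorem proposition3p8 :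
    (∃ v : Fin 4 → Fin 4 → ℝ, IsFundamentalSimplex v) ∧
    ∀ v : Fin 4 → Fin 4 → ℝ, IsFundamentalSimplex v →
      Nonempty (gammaStab (edgeGeodesic v 0 2) ≃* DihedralGroup 2 × DihedralGroup 0) ∧
      Nonempty (gammaStab (edgeGeodesic v 0 1) ≃* DihedralGroup 3 × DihedralGroup 0) ∧
      ∀ i j : Fin 4, i < j → (i, j) ≠ (0, 2) → (i, j) ≠ (0, 1) →
        Finite (gammaStab (edgeGeodesic v i j)) := by
  refine ⟨⟨standardNormal, isFundamentalSimplex_standardNormal⟩, fun v hv => ⟨?_, ?_, ?_⟩⟩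
  · obtain ⟨e⟩ := nonempty_gammaStab_equiv_standard hv 0 2
    obtain ⟨e'⟩ := nonempty_gammaStab_standard_zero_two
    exact ⟨e.trans e'⟩
  · obtain ⟨e⟩ := nonempty_gammaStab_equiv_standard hv 0 1
    obtain ⟨e'⟩ := nonempty_gammaStab_standard_zero_one
    exact ⟨e.trans e'⟩
  · intro i j hij h02 h01
    obtain ⟨e⟩ := nonempty_gammaStab_equiv_standard hv i j
    suffices Finite (gammaStab (edgeGeodesic standardNormal i j)) from
      Finite.of_equiv _ e.symm.toEquiv
    have hcases : ∀ i j : Fin 4, i < j → (i, j) ≠ (0, 2) → (i, j) ≠ (0, 1) →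
        (i = 0 ∧ j = 3) ∨ (i = 1 ∧ j = 2) ∨ (i = 1 ∧ j = 3) ∨ (i = 2 ∧ j = 3) := by
      decide
    rcases hcases i j hij h02 h01 with ⟨rfl, rfl⟩ | ⟨rfl, rfl⟩ | ⟨rfl, rfl⟩ | ⟨rfl, rfl⟩
    exacts [finite_gammaStab_standard_zero_three, finite_gammaStab_standard_one_two,
      finite_gammaStab_standard_one_three, finite_gammaStab_standard_two_three]
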